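/- **Setting.** Consider $n$ banks and a societal node $n+1$. Bank $i$ owes $L_{ij}\ge 0$ to bank $j$ (with $L_{ii}=0$) and $L_{i,n+1}\ge 0$ to society, which owes nothing. Put $\bar p_i=\sum_{j=1}^{n+1}L_{ij}$ and $\pi_{ij}=L_{ij}/\bar p_i$ for $1\le i,j\le n$ (with $\pi_{ij}=0$ if $\bar p_i=0$), and assume that every bank has obligations to society: $\bar p_i>0$ and $\sum_{j=1}^n\pi_{ij}<1$ for all $i$. For endowments $x\in\mathbb R^n_+$ let $V(x)\in\mathbb R^n$ be the greatest clearing wealth vector without bankruptcy costs (the Eisenberg–Noe model), i.e. the greatest $v\in\mathbb R^n$ with $$v_i = x_i+\sum_{j=1}^n\pi_{ji}\,(\bar p_j-v_j^-)-\bar p_i,\qquad i=1,\dots,n,$$ and let $p(x)=\bar p-V(x)^-$ be the associated payments, where $a^-=\max(-a,0)$. **Lemma.** Let $(\Omega,\mathcal F,\mathbb P)$ be a probability space, let $X=(X_1,\dots,X_n)$ be a vector of integrable, almost surely nonnegative random variables on it, with distribution functions $F_{X_1},\dots,F_{X_n}$, and let $U$ be a random variable on $\Omega$ that is uniform on $[0,1]$.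 Put $Z=(F_{X_1}^{-1}(U),\dots,F_{X_n}^{-1}(U))$, where $F_{X_i}^{-1}(u)=\inf\{y\ge 0 : F_{X_i}(y)\ge u\}$. A random vector $Y$ on $\Omega$ is called comonotonic if it is equal in distribution to $f(q)$ for some random variable $q$ on $\Omega$ and some nondecreasing $f:\mathbb R\to\mathbb R^n$. Let $\mathcal U$ be the set of all random variables $W$ on $\Omega$ that are uniform on $[0,1]$ and for which $\mathbb E[X\mid W]$ is comonotonic. Then $\mathcal U\neq\emptyset$, and for every bank $i$ all the expectations below are of integrable random variables, the infima below are finite, and $$\mathbb E[V_i(Z)]\le \mathbb E[V_i(X)]\le \inf_{W\in\mathcal U}\mathbb E\big[V_i(\mathbb E[X\mid W])\big]\le V_i(\mathbb E[X]),$$ $$\mathbb E[p_i(Z)]\le \mathbb E[p_i(X)]\le \inf_{W\in\mathcal U}\mathbb E\big[p_i(\mathbb E[X\mid W])\big]\le p_i(\mathbb E[X]).$$ -/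

import Mathlib

open MeasureTheory ProbabilityTheory

noncomputable section

/-- A network of `n` banks together with a societal node: `liab i j` is the nominal obligation of
bank `i` to bank `j`, and `soc i` is the obligation of bank `i` to society.  No bank owes itself,
and the societal node owes nothing. -/
structure FinancialNetwork (n : ℕ) where
  liab : Fin n → Fin n → ℝ
  soc : Fin n → ℝ
  liab_nonneg : ∀ i j, 0 ≤ liab i j
  soc_nonneg : ∀ i, 0 ≤ soc i
  liab_self : ∀ i, liab i i = 0

namespace FinancialNetwork

variable {n : ℕ} (N : FinancialNetwork n)

/-- Total liabilities `p̄ i`, to the banks and to society. -/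
def totalLiab (i : Fin n) : ℝ := ∑ j, N.liab i j + N.soc i

/-- Relative liabilities `π i j` between banks (equal to `0` when `p̄ i = 0`). -/
def relLiab (i j : Fin n) : ℝ := N.liab i j / N.totalLiab i

/-- Every bank has obligations to the societal node. -/
def OwesSociety : Prop := ∀ i, 0 < N.totalLiab i ∧ ∑ j, N.relLiab i j < 1

/-- The clearing map in wealths, with recovery rates `αx` on external and `αL` on interbank assets
and endowments `x`. -/
def clearingMap (αx αL : ℝ) (x v : Fin n → ℝ) (i : Fin n) : ℝ :=
  (if 0 ≤ v i then 1 else αx) * x i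
    + (if 0 ≤ v i then 1 else αL) * ∑ j, N.relLiab j i * (N.totalLiab j - (v j)⁻)
    - N.totalLiab i

/-- The clearing wealth vectors: the fixed points of the clearing map. -/
def clearingSet (αx αL : ℝ) (x : Fin n → ℝ) : Set (Fin n → ℝ) :=
  {v | N.clearingMap αx αL x v = v}

open Classical in
/-- The greatest clearing wealth vector `V(x)`; it exists whenever `x ≥ 0` and `αx, αL ∈ [0,1]`,
see `isGreatest_wealth`.  (The value is `0` if there is none.) -/
def wealth (αx αL : ℝ) (x : Fin n → ℝ) : Fin n → ℝ :=
  if h : ∃ v, IsGreatest (N.clearingSet αx αL x) v then h.choose else 0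

/-- The payments `p(x) = p̄ - V(x)⁻`. -/
def payment (αx αL : ℝ) (x : Fin n → ℝ) (i : Fin n) : ℝ :=
  N.totalLiab i - (N.wealth αx αL x i)⁻

/-- The clearing map with payments truncated at zero. -/
def truncMap (αx αL : ℝ) (x v : Fin n → ℝ) (i : Fin n) : ℝ :=
  (if 0 ≤ v i then 1 else αx) * x i
    + (if 0 ≤ v i then 1 else αL) * ∑ j, N.relLiab j i * max (N.totalLiab j - (v j)⁻) 0
    - N.totalLiab i

lemma totalLiab_nonneg (i : Fin n) : 0 ≤ N.totalLiab i :=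
  add_nonneg (Finset.sum_nonneg fun j _ => N.liab_nonneg i j) (N.soc_nonneg i)

lemma relLiab_nonneg (i j : Fin n) : 0 ≤ N.relLiab i j :=
  div_nonneg (N.liab_nonneg i j) (N.totalLiab_nonneg i)

theorem exists_isGreatest_clearingSet {αx αL : ℝ} (hx0 : 0 ≤ αx) (hx1 : αx ≤ 1) (hL0 : 0 ≤ αL)
    (hL1 : αL ≤ 1) {x : Fin n → ℝ} (hx : 0 ≤ x) :
    ∃ v, IsGreatest (N.clearingSet αx αL x) v := by
  have hS : ∀ (v : Fin n → ℝ) (i : Fin n), 0 ≤ ∑ j, N.relLiab j i * max (N.totalLiab j - (v j)⁻) 0 := fun v i =>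
    Finset.sum_nonneg fun j _ => mul_nonneg (N.relLiab_nonneg j i) (le_max_right _ _)
  have hmono : ∀ v w : Fin n → ℝ, v ≤ w → N.truncMap αx αL x v ≤ N.truncMap αx αL x w := by
    intro v w hvw i
    have hsum : ∑ j, N.relLiab j i * max (N.totalLiab j - (v j)⁻) 0
        ≤ ∑ j, N.relLiab j i * max (N.totalLiab j - (w j)⁻) 0 := by
      refine Finset.sum_le_sum fun j _ => mul_le_mul_of_nonneg_left ?_ (N.relLiab_nonneg j i)
      exact max_le_max (sub_le_sub_left (negPart_anti (hvw j)) _) le_rfl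
    have hc : ∀ a : ℝ, a ≤ 1 → (if 0 ≤ v i then 1 else a) ≤ (if 0 ≤ w i then 1 else a) := by
      intro a ha
      have := hvw i
      split_ifs <;> linarith
    have hp : ∀ a : ℝ, 0 ≤ a → (0 : ℝ) ≤ (if 0 ≤ w i then 1 else a) := by
      intro a ha
      split_ifs <;> linarith
    unfold truncMap
    have h1 := mul_le_mul_of_nonneg_right (hc αx hx1) (hx i)
    have h2 := mul_le_mul (hc αL hL1) hsum (hS v i) (hp αL hL0)
    linarith
  have hlow : ∀ (v : Fin n → ℝ) (i : Fin n), -N.totalLiab i ≤ N.truncMap αx αL x v i := by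
    intro v i
    have hp : ∀ a : ℝ, 0 ≤ a → (0 : ℝ) ≤ (if 0 ≤ v i then 1 else a) := by
      intro a ha
      split_ifs <;> linarith
    unfold truncMap
    have h1 := mul_nonneg (hp αx hx0) (hx i)
    have h2 := mul_nonneg (hp αL hL0) (hS v i)
    linarith
  have hup : ∀ v, N.truncMap αx αL x v ≤ N.truncMap αx αL x 0 := by
    intro v
    have h := hmono v (v ⊔ 0) le_sup_left
    refine h.trans (le_of_eq ?_)
    funext i
    simp [truncMap]
  let S : Set (Fin n → ℝ) := {v | v ≤ N.truncMap αx αL x v}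
  have hne : S.Nonempty := ⟨fun i => -N.totalLiab i, fun i => hlow _ i⟩
  have hbdd : BddAbove S := ⟨_, fun v hv => le_trans hv (hup v)⟩
  let u := sSup S
  have hu1 : u ≤ N.truncMap αx αL x u :=
    csSup_le hne fun v hv => le_trans hv (hmono _ _ (le_csSup hbdd hv))
  have hu2 : N.truncMap αx αL x u ≤ u := le_csSup hbdd (hmono _ _ hu1)
  have hu : N.truncMap αx αL x u = u := le_antisymm hu2 hu1
  refine ⟨u, ?_, ?_⟩
  · have hj : ∀ j, 0 ≤ N.totalLiab j - (u j)⁻ := by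
      intro j
      have h1 := hlow u j
      rw [hu] at h1
      have h2 : (u j)⁻ ≤ N.totalLiab j := by
        rw [negPart_def]
        exact sup_le (by linarith) (N.totalLiab_nonneg j)
      linarith
    change N.clearingMap αx αL x u = u
    refine Eq.trans ?_ hu
    funext i
    simp only [clearingMap, truncMap, max_eq_left (hj _)]
  · intro v hv
    refine le_csSup hbdd ?_
    intro i
    have h : N.clearingMap αx αL x v i = v i := congrFun hv i
    rw [← h]
    have hp : (0 : ℝ) ≤ (if 0 ≤ v i then 1 else αL) := by
      split_ifs <;> linarith
    have hs : ∑ j, N.relLiab j i * (N.totalLiab j - (v j)⁻)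
        ≤ ∑ j, N.relLiab j i * max (N.totalLiab j - (v j)⁻) 0 :=
      Finset.sum_le_sum fun j _ =>
        mul_le_mul_of_nonneg_left (le_max_left _ _) (N.relLiab_nonneg j i)
    have := mul_le_mul_of_nonneg_left hs hp
    unfold clearingMap truncMap
    linarith

theorem isGreatest_wealth {αx αL : ℝ} (hx0 : 0 ≤ αx) (hx1 : αx ≤ 1) (hL0 : 0 ≤ αL)
    (hL1 : αL ≤ 1) {x : Fin n → ℝ} (hx : 0 ≤ x) :
    IsGreatest (N.clearingSet αx αL x) (N.wealth αx αL x) := by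
  have h := N.exists_isGreatest_clearingSet hx0 hx1 hL0 hL1 hx
  rw [wealth, dif_pos h]
  exact h.choose_spec

end FinancialNetwork

/-- The generalized inverse `F⁻¹(u) = inf {y ≥ 0 | F(y) ≥ u}` of the distribution function `F` of
a law `μ` on the nonnegative half-line. -/
def quantile (μ : Measure ℝ) (u : ℝ) : ℝ := sInf {y : ℝ | 0 ≤ y ∧ u ≤ cdf μ y}

section Endowments

variable {Ω : Type*} [MeasurableSpace Ω] {n : ℕ}

/-- The comonotonic rearrangement `Z = (F_{X₁}⁻¹(U), …, F_{Xₙ}⁻¹(U))`. -/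
def comonotonicRearrangement (P : Measure Ω) (X : Ω → Fin n → ℝ) (U : Ω → ℝ) :
    Ω → Fin n → ℝ :=
  fun ω i => quantile (P.map fun ω' => X ω' i) (U ω)

/-- `Y` is comonotonic: it has the law of `f(q)` for a random variable `q` and a nondecreasing
`f : ℝ → ℝⁿ`. -/
def IsComonotonic (P : Measure Ω) (Y : Ω → Fin n → ℝ) : Prop :=
  ∃ q : Ω → ℝ, Measurable q ∧ ∃ f : ℝ → Fin n → ℝ, Monotone f ∧
    IdentDistrib Y (fun ω => f (q ω)) P P

/-- The conditional expectation `E[X | W]` of a random vector given a random variable `W`. -/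
def condMean (P : Measure Ω) (X : Ω → Fin n → ℝ) (W : Ω → ℝ) : Ω → Fin n → ℝ :=
  fun ω i => (P[fun ω' => X ω' i | MeasurableSpace.comap W inferInstance]) ω

/-- The set `𝒰` of the uniform random variables `W` on `[0,1]` for which `E[X | W]` is
comonotonic. -/
def comonotonicFactors (P : Measure Ω) (X : Ω → Fin n → ℝ) : Set (Ω → ℝ) :=
  {W | Measurable W ∧ pdf.IsUniform W (Set.Icc 0 1) P volume ∧ IsComonotonic P (condMean P X W)}

end Endowments

end

/-! ### Clearing wealths and payments as monotone submodular functions of the endowment -/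

noncomputable section

/-! Since every bank owes society, the interbank matrix has row sums below 1, so subsolutions of the
clearing equation lie below supersolutions (`OwesSociety.comparison`). Two consequences of the
concavity of `v ↦ -v⁻` carry the proof.

Jensen: `p̄ - v⁻` is the minimum of `p̄` and `p̄ + v`, so conditioning the clearing equation makes
`E[V(X) | m]` a subsolution for the endowment `E[X | m]`, hence at most `V(E[X | m])`. This gives
the middle inequality for every `W`, and with the tower property also the last one, provided that
some `W` exists.

Submodularity: `V(x) + V(y) - V(x ⊓ y)` is a supersolution for `x ⊔ y`, so `V` and then `p` are
submodular. Among vectors with given margins the comonotonic one minimizes the mean of a submodular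
function `f`: along a chain `f` has separable minorants that are exact on the chain
(`IsMonoSubmodular.exists_potential`), and the mean of a separable function depends only on the
margins. A grid and a truncation reduce the comonotonic curve to a finite chain.

Existence of `W`: a Lyapunov-type halving argument gives a `W` that is uniform under `P` and, up to
total mass, under all the measures with densities `X i`. Then `E[X | W]` is constant, hence
comonotonic. -/

lemma negPart_sub_le_max_sub (a b : ℝ) : b⁻ - a⁻ ≤ max (a - b) 0 := by
  simp only [negPart_def]
  rcases max_cases (-a) 0 with h | h <;> rcases max_cases (-b) 0 with h' | h' <;>
    rcases max_cases (a - b) 0 with h'' | h'' <;> simp only [max_def] at * <;> grind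

/-- Convexity of the negative part: `b` and `c` lie between `a` and `b + c - a` and have the same
sum as these endpoints. -/
lemma negPart_add_negPart_le {a b c : ℝ} (hb : a ≤ b) (hc : a ≤ c) :
    b⁻ + c⁻ ≤ (b + c - a)⁻ + a⁻ := by
  simp only [negPart_def, max_def]
  grind

lemma abs_negPart_sub_negPart_le (a b : ℝ) : |a⁻ - b⁻| ≤ |a - b| := by
  simp only [negPart_def]
  calc |max (-a) 0 - max (-b) 0| ≤ |(-a) - (-b)| := abs_max_sub_max_le_abs _ _ _
    _ = |a - b| := by rw [abs_sub_comm]; ring_nf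

/-- A function which is nondecreasing, submodular and Lipschitz for the `ℓ¹` norm. -/
structure IsMonoSubmodular {ι : Type*} [Fintype ι] (f : (ι → ℝ) → ℝ) : Prop where
  mono : Monotone f
  submodular : ∀ x y, f (x ⊔ y) + f (x ⊓ y) ≤ f x + f y
  lipschitz : ∃ C, 0 ≤ C ∧ ∀ x y, |f x - f y| ≤ C * ∑ i, |x i - y i|

namespace FinancialNetwork

variable {n : ℕ} (N : FinancialNetwork n)

lemma clearingMap_one (x v : Fin n → ℝ) (i : Fin n) :
    N.clearingMap 1 1 x v i
      = x i + ∑ j, N.relLiab j i * (N.totalLiab j - (v j)⁻) - N.totalLiab i := by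
  simp [clearingMap]

variable {N}

/-- When every bank owes society, subsolutions of the linearized clearing system are controlled by
the inhomogeneity. -/
lemma OwesSociety.exists_bound (hN : N.OwesSociety) :
    ∃ C, 0 ≤ C ∧ ∀ e d : Fin n → ℝ, 0 ≤ e →
      (∀ i, e i ≤ d i + ∑ j, N.relLiab j i * e j) → ∀ i, e i ≤ C * ∑ j, d j := by
  obtain ⟨δ, hδ, hδle⟩ : ∃ δ : ℝ, 0 < δ ∧ ∀ i, δ ≤ 1 - ∑ j, N.relLiab i j := by
    rcases isEmpty_or_nonempty (Fin n) with h | h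
    · exact ⟨1, one_pos, fun i => isEmptyElim i⟩
    · obtain ⟨i, hi⟩ := Finite.exists_min (fun i => 1 - ∑ j, N.relLiab i j)
      exact ⟨_, sub_pos.2 (hN i).2, hi⟩
  -- `δ` is the least share of its liabilities that a bank owes society. Summing the inequalities
  -- over `i` gives `δ * ∑ e ≤ ∑ d`.
  refine ⟨δ⁻¹, inv_nonneg.2 hδ.le, fun e d he h i => ?_⟩
  have hsum : ∑ i, e i ≤ ∑ i, d i + ∑ j, (∑ i, N.relLiab j i) * e j := by
    calc ∑ i, e i ≤ ∑ i, (d i + ∑ j, N.relLiab j i * e j) := Finset.sum_le_sum fun i _ => h i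
      _ = _ := by
        rw [Finset.sum_add_distrib, Finset.sum_comm]
        simp_rw [Finset.sum_mul]
  have hle : δ * ∑ j, e j ≤ ∑ j, d j := by
    have h1 : δ * ∑ j, e j ≤ ∑ j, (1 - ∑ i, N.relLiab j i) * e j := by
      rw [Finset.mul_sum]
      exact Finset.sum_le_sum fun j _ => mul_le_mul_of_nonneg_right (hδle j) (he j)
    have h2 : ∑ j, (1 - ∑ i, N.relLiab j i) * e j
        = ∑ j, e j - ∑ j, (∑ i, N.relLiab j i) * e j := by
      rw [← Finset.sum_sub_distrib]
      exact Finset.sum_congr rfl fun j _ => by ring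
    linarith
  have h3 : e i ≤ ∑ j, e j := Finset.single_le_sum (fun j _ => he j) (Finset.mem_univ i)
  rw [inv_mul_eq_div, le_div_iff₀ hδ]
  nlinarith

/-- Comparison principle for the Eisenberg–Noe clearing map. -/
lemma OwesSociety.comparison (hN : N.OwesSociety) {x y v w : Fin n → ℝ} (hxy : x ≤ y)
    (hv : v ≤ N.clearingMap 1 1 x v) (hw : N.clearingMap 1 1 y w ≤ w) : v ≤ w := by
  obtain ⟨C, -, hC⟩ := hN.exists_bound
  intro i
  -- The excess `(v - w)⁺` satisfies the linear inequality with inhomogeneity 0, so it vanishes.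
  have h := hC (fun i => max (v i - w i) 0) 0 (fun i => le_max_right _ _) (fun i => ?_) i
  · have h0 := le_max_left (v i - w i) 0
    simp at h
    linarith
  · have hnn : 0 ≤ ∑ j, N.relLiab j i * max (v j - w j) 0 :=
      Finset.sum_nonneg fun j _ => mul_nonneg (N.relLiab_nonneg j i) (le_max_right _ _)
    have h1 := hv i
    have h2 := hw i
    rw [clearingMap_one] at h1 h2
    have h3 : ∑ j, N.relLiab j i * (N.totalLiab j - (v j)⁻)
        ≤ ∑ j, N.relLiab j i * (N.totalLiab j - (w j)⁻)
          + ∑ j, N.relLiab j i * max (v j - w j) 0 := by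
      rw [← Finset.sum_add_distrib]
      refine Finset.sum_le_sum fun j _ => ?_
      rw [← mul_add]
      refine mul_le_mul_of_nonneg_left ?_ (N.relLiab_nonneg j i)
      linarith [negPart_sub_le_max_sub (v j) (w j)]
    simp only [Pi.zero_apply, zero_add]
    exact max_le (by linarith [hxy i]) hnn

lemma clearingMap_wealth {x : Fin n → ℝ} (hx : 0 ≤ x) :
    N.clearingMap 1 1 x (N.wealth 1 1 x) = N.wealth 1 1 x :=
  (N.isGreatest_wealth zero_le_one le_rfl zero_le_one le_rfl hx).1

lemma wealth_eq {x : Fin n → ℝ} (hx : 0 ≤ x) (i : Fin n) :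
    N.wealth 1 1 x i = x i + ∑ j, N.relLiab j i * (N.totalLiab j - (N.wealth 1 1 x j)⁻)
      - N.totalLiab i := by
  rw [← clearingMap_one, clearingMap_wealth hx]

lemma OwesSociety.le_wealth (hN : N.OwesSociety) {x v : Fin n → ℝ} (hx : 0 ≤ x)
    (hv : v ≤ N.clearingMap 1 1 x v) : v ≤ N.wealth 1 1 x :=
  hN.comparison le_rfl hv (clearingMap_wealth hx).le

lemma OwesSociety.wealth_mono (hN : N.OwesSociety) {x y : Fin n → ℝ} (hx : 0 ≤ x) (hxy : x ≤ y) :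
    N.wealth 1 1 x ≤ N.wealth 1 1 y :=
  hN.comparison hxy (clearingMap_wealth hx).ge (clearingMap_wealth (hx.trans hxy)).le

/-- The right-hand side is a supersolution for `x ⊔ y`: the endowments add up exactly, and concavity
of the payments applies because `V(x ⊓ y)` lies below both `V(x)` and `V(y)`. -/
lemma OwesSociety.wealth_submodular (hN : N.OwesSociety) {x y : Fin n → ℝ} (hx : 0 ≤ x)
    (hy : 0 ≤ y) :
    N.wealth 1 1 (x ⊔ y) ≤ N.wealth 1 1 x + N.wealth 1 1 y - N.wealth 1 1 (x ⊓ y) := by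
  have hxy : 0 ≤ x ⊓ y := le_inf hx hy
  refine hN.comparison le_rfl (clearingMap_wealth (hx.trans le_sup_left)).ge fun i => ?_
  have hmx := hN.wealth_mono hxy (inf_le_left : x ⊓ y ≤ x)
  have hmy := hN.wealth_mono hxy (inf_le_right : x ⊓ y ≤ y)
  rw [clearingMap_one]
  simp only [Pi.add_apply, Pi.sub_apply]
  rw [wealth_eq hx i, wealth_eq hy i, wealth_eq hxy i]
  have h1 : ∑ j, N.relLiab j i * (N.totalLiab j
        - (N.wealth 1 1 x j + N.wealth 1 1 y j - N.wealth 1 1 (x ⊓ y) j)⁻)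
      ≤ ∑ j, N.relLiab j i * (N.totalLiab j - (N.wealth 1 1 x j)⁻)
        + ∑ j, N.relLiab j i * (N.totalLiab j - (N.wealth 1 1 y j)⁻)
        - ∑ j, N.relLiab j i * (N.totalLiab j - (N.wealth 1 1 (x ⊓ y) j)⁻) := by
    rw [← Finset.sum_add_distrib, ← Finset.sum_sub_distrib]
    refine Finset.sum_le_sum fun j _ => ?_
    rw [← mul_add, ← mul_sub]
    refine mul_le_mul_of_nonneg_left ?_ (N.relLiab_nonneg j i)
    linarith [negPart_add_negPart_le (hmx j) (hmy j)]
  have h2 : (x ⊔ y) i + (x ⊓ y) i = x i + y i := by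
    simp only [Pi.sup_apply, Pi.inf_apply]
    exact max_add_min _ _
  linarith

lemma OwesSociety.wealth_lipschitz (hN : N.OwesSociety) :
    ∃ C, 0 ≤ C ∧ ∀ x y : Fin n → ℝ, 0 ≤ x → 0 ≤ y → ∀ i,
      |N.wealth 1 1 x i - N.wealth 1 1 y i| ≤ C * ∑ j, |x j - y j| := by
  obtain ⟨C, hC0, hC⟩ := hN.exists_bound
  refine ⟨C, hC0, fun x y hx hy => ?_⟩
  refine hC (fun i => |N.wealth 1 1 x i - N.wealth 1 1 y i|) (fun j => |x j - y j|)
    (fun i => abs_nonneg _) fun i => ?_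
  have h : N.wealth 1 1 x i - N.wealth 1 1 y i = (x i - y i)
      + ∑ j, N.relLiab j i * ((N.wealth 1 1 y j)⁻ - (N.wealth 1 1 x j)⁻) := by
    rw [wealth_eq hx i, wealth_eq hy i]
    have : ∑ j, N.relLiab j i * ((N.wealth 1 1 y j)⁻ - (N.wealth 1 1 x j)⁻)
        = ∑ j, N.relLiab j i * (N.totalLiab j - (N.wealth 1 1 x j)⁻)
          - ∑ j, N.relLiab j i * (N.totalLiab j - (N.wealth 1 1 y j)⁻) := by
      rw [← Finset.sum_sub_distrib]
      exact Finset.sum_congr rfl fun j _ => by ring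
    rw [this]
    ring
  rw [h]
  refine (abs_add_le _ _).trans (add_le_add le_rfl ?_)
  refine (Finset.abs_sum_le_sum_abs _ _).trans (Finset.sum_le_sum fun j _ => ?_)
  rw [abs_mul, abs_of_nonneg (N.relLiab_nonneg j i), abs_sub_comm]
  exact mul_le_mul_of_nonneg_left (abs_negPart_sub_negPart_le _ _) (N.relLiab_nonneg j i)

/-- Taking `x ⊔ 0` extends the function from the orthant to the whole space. Submodularity survives
by distributivity of the lattice, and almost surely nonnegative endowments do not notice. -/
lemma OwesSociety.isMonoSubmodular_wealth (hN : N.OwesSociety) (i : Fin n) :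
    IsMonoSubmodular fun x : Fin n → ℝ => N.wealth 1 1 (x ⊔ 0) i where
  mono x y hxy := hN.wealth_mono le_sup_right (sup_le_sup_right hxy 0) i
  submodular x y := by
    have h := hN.wealth_submodular (x := x ⊔ 0) (y := y ⊔ 0) le_sup_right le_sup_right i
    rw [← sup_inf_right, ← sup_sup_distrib_right] at h
    simp only [Pi.add_apply, Pi.sub_apply] at h
    linarith
  lipschitz := by
    obtain ⟨C, hC0, hC⟩ := hN.wealth_lipschitz
    refine ⟨C, hC0, fun x y => (hC _ _ le_sup_right le_sup_right i).trans ?_⟩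
    refine mul_le_mul_of_nonneg_left (Finset.sum_le_sum fun j _ => ?_) hC0
    exact abs_max_sub_max_le_abs _ _ _

/-- A nondecreasing concave function of a monotone submodular function is again monotone submodular.
-/
lemma OwesSociety.isMonoSubmodular_payment (hN : N.OwesSociety) (i : Fin n) :
    IsMonoSubmodular fun x : Fin n → ℝ => N.payment 1 1 (x ⊔ 0) i where
  mono x y hxy := sub_le_sub_left (negPart_anti ((hN.isMonoSubmodular_wealth i).mono hxy)) _
  submodular x y := by
    have h := (hN.isMonoSubmodular_wealth i).submodular x y
    have hx := (hN.isMonoSubmodular_wealth i).mono (inf_le_left : x ⊓ y ≤ x)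
    have hy := (hN.isMonoSubmodular_wealth i).mono (inf_le_right : x ⊓ y ≤ y)
    have h1 := negPart_add_negPart_le hx hy
    have h2 := negPart_anti (le_sub_iff_add_le.2 h)
    simp only [payment] at *
    linarith
  lipschitz := by
    obtain ⟨C, hC0, hC⟩ := (hN.isMonoSubmodular_wealth i).lipschitz
    refine ⟨C, hC0, fun x y => le_trans ?_ (hC x y)⟩
    simp only [payment]
    rw [sub_sub_sub_cancel_left, abs_sub_comm]
    exact abs_negPart_sub_negPart_le _ _

end FinancialNetwork

end

/-! ### Separable minorants of submodular functions -/

noncomputable section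

namespace IsMonoSubmodular

variable {ι : Type*} [Fintype ι] {f : (ι → ℝ) → ℝ}

/-- Raise the coordinates from `a` to `b` one at a time; `φ i` records the increment of `f` while
coordinate `i` moves. By submodularity this increment is no larger than the one seen from the lower
point `x ⊓ w`, and the increments telescope. -/
lemma exists_step_potential [DecidableEq ι] (hf : IsMonoSubmodular f) {a b : ι → ℝ} (hab : a ≤ b)
    (s : Finset ι) :
    ∃ φ : ι → ℝ → ℝ, (∀ j, Monotone (φ j)) ∧ (∀ j y, y ≤ a j → φ j y = 0) ∧
      (∀ j y, b j ≤ y → φ j y = φ j (b j)) ∧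
      (∀ x : ι → ℝ, ∑ j ∈ s, φ j (x j) ≤ f (x ⊓ s.piecewise b a) - f (x ⊓ a)) ∧
      ∑ j ∈ s, φ j (b j) = f (s.piecewise b a) - f a := by
  induction s using Finset.induction_on with
  | empty => exact ⟨0, fun _ => monotone_const, by simp, by simp, by simp, by simp⟩
  | insert i s hi ih =>
    obtain ⟨φ, hmono, h0, hb, hle, heq⟩ := ih
    set w := s.piecewise b a with hw
    have hwi : w i = a i := by simp [hw, hi]
    -- Clamping `y` to `[a i, b i]` makes the potential zero below the step and constant above it.
    let ψ : ℝ → ℝ := fun y => f (Function.update w i (max (a i) (min y (b i)))) - f w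
    have hins : (insert i s).piecewise b a = Function.update w i (b i) :=
      Finset.piecewise_insert s b a i
    have hsum : ∀ x : ι → ℝ, ∑ j ∈ s, Function.update φ i ψ j (x j) = ∑ j ∈ s, φ j (x j) :=
      fun x => Finset.sum_congr rfl fun j hj => by
        rw [Function.update_of_ne (ne_of_mem_of_not_mem hj hi)]
    refine ⟨Function.update φ i ψ, fun j => ?_, fun j y hy => ?_, fun j y hy => ?_, fun x => ?_, ?_⟩
    · rcases eq_or_ne j i with rfl | hj
      · rw [Function.update_self]
        intro y z hyz
        refine sub_le_sub_right (hf.mono (update_le_update_iff.2 ⟨?_, fun _ _ => le_rfl⟩)) _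
        exact max_le_max le_rfl (min_le_min_right _ hyz)
      · rw [Function.update_of_ne hj]
        exact hmono j
    · rcases eq_or_ne j i with rfl | hj
      · rw [Function.update_self]
        simp only [ψ]
        rw [min_eq_left (hy.trans (hab j)), max_eq_left hy, ← hwi, Function.update_eq_self, sub_self]
      · rw [Function.update_of_ne hj]
        exact h0 j y hy
    · rcases eq_or_ne j i with rfl | hj
      · rw [Function.update_self]
        simp only [ψ]
        rw [min_eq_right hy, min_self]
      · rw [Function.update_of_ne hj]
        exact hb j y hy
    · rw [Finset.sum_insert hi, hsum, Function.update_self, hins]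
      have hinf : (x ⊓ Function.update w i (b i)) ⊓ w = x ⊓ w := by
        have hle : w ≤ Function.update w i (b i) :=
          le_update_iff.2 ⟨hwi.trans_le (hab i), fun _ _ => le_rfl⟩
        rw [inf_assoc, inf_eq_right.2 hle]
      have hsup : (x ⊓ Function.update w i (b i)) ⊔ w
          = Function.update w i (max (a i) (min (x i) (b i))) := by
        funext j
        rcases eq_or_ne j i with rfl | hj
        · simp [hwi, max_comm]
        · simp [hj]
      have h := hf.submodular (x ⊓ Function.update w i (b i)) w
      rw [hinf, hsup] at h
      have h1 := hle x
      simp only [ψ]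
      linarith
    · rw [Finset.sum_insert hi, hsum b, Function.update_self, hins, heq]
      simp only [ψ, min_self]
      rw [max_eq_right (hab i)]
      ring

/-- Separable minorants of a submodular function which are exact along a monotone chain. -/
lemma exists_potential (hf : IsMonoSubmodular f) {z : ℕ → ι → ℝ} (hz : Monotone z) (m : ℕ) :
    ∃ h : ι → ℝ → ℝ, (∀ j, Monotone (h j)) ∧ (∀ j y, y ≤ z 0 j → h j y = 0) ∧
      (∀ j y, z m j ≤ y → h j y = h j (z m j)) ∧
      (∀ x : ι → ℝ, ∑ j, h j (x j) ≤ f (x ⊓ z m) - f (x ⊓ z 0)) ∧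
      ∀ k ≤ m, ∑ j, h j (z k j) = f (z k) - f (z 0) := by
  induction m with
  | zero =>
    exact ⟨0, fun _ => monotone_const, by simp, by simp, by simp, fun k hk => by
      simp [Nat.le_zero.1 hk]⟩
  | succ m ih =>
    obtain ⟨h, hmono, h0, hb, hle, heq⟩ := ih
    classical
    obtain ⟨φ, pmono, p0, pb, ple, peq⟩ := hf.exists_step_potential (hz m.le_succ) Finset.univ
    rw [Finset.piecewise_univ] at peq
    simp only [Finset.piecewise_univ] at ple
    have hz' := fun j => hz m.le_succ j
    -- The new potential vanishes up to `z m` and the old one is constant from `z m` on, so adding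
    -- them keeps exactness at earlier points and telescopes at the new one.
    refine ⟨h + φ, fun j => (hmono j).add (pmono j), fun j y hy => ?_, fun j y hy => ?_,
      fun x => ?_, fun k hk => ?_⟩
    · simp [h0 j y hy, p0 j y (hy.trans (hz m.zero_le j))]
    · simp only [Pi.add_apply]
      rw [pb j y hy, hb j y ((hz' j).trans hy), hb j _ (hz' j)]
    · simp only [Pi.add_apply, Finset.sum_add_distrib]
      linarith [hle x, ple x]
    · simp only [Pi.add_apply, Finset.sum_add_distrib]
      rcases hk.lt_or_eq with hk | rfl
      · rw [heq k (Nat.lt_succ_iff.1 hk), Finset.sum_eq_zero (fun j _ => p0 j _ ?_), add_zero]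
        exact hz (Nat.lt_succ_iff.1 hk) j
      · rw [peq, Finset.sum_congr rfl fun j _ => hb j _ (hz' j), heq m le_rfl]
        ring

lemma continuous (hf : IsMonoSubmodular f) : Continuous f := by
  obtain ⟨C, -, hC⟩ := hf.lipschitz
  refine continuous_iff_continuousAt.2 fun x => ?_
  refine tendsto_iff_norm_sub_tendsto_zero.2 ?_
  refine squeeze_zero (fun _ => norm_nonneg _) (fun y => hC y x) ?_
  have : Continuous fun y : ι → ℝ => C * ∑ i, |y i - x i| := by fun_prop
  simpa using this.tendsto x

lemma integrable_comp (hf : IsMonoSubmodular f) {Ω : Type*} [MeasurableSpace Ω] {P : Measure Ω}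
    [IsFiniteMeasure P] {Y : Ω → ι → ℝ} (hY : ∀ i, Integrable (fun ω => Y ω i) P) :
    Integrable (fun ω => f (Y ω)) P := by
  obtain ⟨C, hC0, hC⟩ := hf.lipschitz
  have hg : Integrable (fun ω => |f 0| + C * ∑ i, |Y ω i|) P :=
    (integrable_const _).add ((integrable_finsetSum _ fun i _ => (hY i).abs).const_mul C)
  refine hg.mono' ?_ (ae_of_all _ fun ω => ?_)
  · exact (hf.continuous.measurable.comp_aemeasurable
      (aemeasurable_pi_lambda _ fun i => (hY i).aemeasurable)).aestronglyMeasurable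
  · have h := hC (Y ω) 0
    simp only [Pi.zero_apply, sub_zero] at h
    have h1 : |f (Y ω)| ≤ |f 0| + |f (Y ω) - f 0| := by
      simpa using abs_add_le (f 0) (f (Y ω) - f 0)
    rw [Real.norm_eq_abs]
    linarith

end IsMonoSubmodular

end

/-! ### Quantile functions and the uniform law -/

noncomputable section

open Filter Topology Set

section Quantile

variable {μ : Measure ℝ}

lemma quantile_nonneg (u : ℝ) : 0 ≤ quantile μ u := Real.sInf_nonneg fun _ h => h.1

lemma nonempty_quantile_set {u : ℝ} (hu : u < 1) : {y : ℝ | 0 ≤ y ∧ u ≤ cdf μ y}.Nonempty := by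
  obtain ⟨y, hy, hy0⟩ :=
    (((tendsto_cdf_atTop μ).eventually (lt_mem_nhds hu)).and (eventually_ge_atTop 0)).exists
  exact ⟨y, hy0, hy.le⟩

/-- Right-continuity of the distribution function gives the nontrivial direction. -/
lemma quantile_le_iff {u y : ℝ} (hu : u < 1) (hy : 0 ≤ y) :
    quantile μ u ≤ y ↔ u ≤ cdf μ y := by
  refine ⟨fun h => ?_, fun h => csInf_le ⟨0, fun _ h => h.1⟩ ⟨hy, h⟩⟩
  have hright : Tendsto (cdf μ) (𝓝[>] y) (𝓝 (cdf μ y)) :=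
    ((cdf μ).right_continuous y).tendsto.mono_left (nhdsWithin_mono _ Ioi_subset_Ici_self)
  refine ge_of_tendsto hright (eventually_nhdsWithin_of_forall fun z hz => ?_)
  obtain ⟨s, hs, hsz⟩ := exists_lt_of_csInf_lt (nonempty_quantile_set hu) (h.trans_lt hz)
  exact hs.2.trans (monotone_cdf μ hsz.le)

/-- At `u = 1` the defining set can be empty, and then the infimum takes the default value 0;
monotonicity is only claimed below 1. -/
lemma monotoneOn_quantile : MonotoneOn (quantile μ) (Iio 1) := fun _ _ _ hv huv =>
  csInf_le_csInf ⟨0, fun _ h => h.1⟩ (nonempty_quantile_set hv) fun _ h => ⟨h.1, huv.trans h.2⟩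

lemma aemeasurable_quantile : AEMeasurable (quantile μ) (volume.restrict (Icc 0 1)) := by
  rw [← Measure.restrict_congr_set Ioo_ae_eq_Icc]
  exact aemeasurable_restrict_of_monotoneOn measurableSet_Ioo
    (monotoneOn_quantile.mono fun _ h => h.2)

lemma map_quantile [IsProbabilityMeasure μ] (hμ : ∀ᵐ y ∂μ, 0 ≤ y) :
    (volume.restrict (Icc (0 : ℝ) 1)).map (quantile μ) = μ := by
  have : IsFiniteMeasure ((volume.restrict (Icc (0 : ℝ) 1)).map (quantile μ)) := by
    infer_instance
  refine Measure.ext_of_Iic _ _ fun y => ?_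
  rw [Measure.map_apply_of_aemeasurable aemeasurable_quantile measurableSet_Iic]
  rcases lt_or_ge y 0 with hy | hy
  · have h1 : quantile μ ⁻¹' Iic y = ∅ := by
      ext u
      simpa using hy.trans_le (quantile_nonneg u)
    rw [h1, measure_empty, eq_comm]
    exact measure_mono_null (fun z hz => not_le.2 ((mem_Iic.1 hz).trans_lt hy)) (ae_iff.1 hμ)
  · rw [← Measure.restrict_congr_set Ioo_ae_eq_Icc, Measure.restrict_apply' measurableSet_Ioo]
    have h1 : quantile μ ⁻¹' Iic y ∩ Ioo 0 1 = Iic (cdf μ y) ∩ Ioo 0 1 := by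
      ext u
      simp only [mem_inter_iff, mem_preimage, mem_Iic, and_congr_left_iff]
      exact fun hu => quantile_le_iff hu.2 hy
    rw [h1, ← Measure.restrict_apply' measurableSet_Ioo, Measure.restrict_congr_set Ioo_ae_eq_Ioc,
      Measure.restrict_apply' measurableSet_Ioc, inter_comm, Ioc_inter_Iic,
      min_eq_right (cdf_le_one μ y), Real.volume_Ioc, sub_zero, ofReal_cdf]

end Quantile

section Uniform

variable {Ω : Type*} [MeasurableSpace Ω] {P : Measure Ω} {U : Ω → ℝ}

lemma isUniform_Icc_iff : pdf.IsUniform U (Icc 0 1) P volume ↔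
    P.map U = volume.restrict (Icc 0 1) := by
  simp [pdf.IsUniform, ProbabilityTheory.cond]

lemma aemeasurable_of_isUniform (hU : pdf.IsUniform U (Icc 0 1) P volume) : AEMeasurable U P :=
  hU.aemeasurable (by simp) (by simp)

lemma ae_mem_Ioo_of_isUniform (hU : pdf.IsUniform U (Icc 0 1) P volume) :
    ∀ᵐ ω ∂P, U ω ∈ Ioo (0 : ℝ) 1 := by
  have h : ∀ᵐ u ∂P.map U, u ∈ Ioo (0 : ℝ) 1 := by
    rw [isUniform_Icc_iff.1 hU, ← Measure.restrict_congr_set Ioo_ae_eq_Icc]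
    exact ae_restrict_mem measurableSet_Ioo
  exact ae_of_ae_map (aemeasurable_of_isUniform hU) h

lemma identDistrib_quantile [IsProbabilityMeasure P] (hU : pdf.IsUniform U (Icc 0 1) P volume)
    {X : Ω → ℝ} (hX : AEMeasurable X P) (hX0 : ∀ᵐ ω ∂P, 0 ≤ X ω) :
    IdentDistrib (fun ω => quantile (P.map X) (U ω)) X P P := by
  have hUm := aemeasurable_of_isUniform hU
  have hmap := isUniform_Icc_iff.1 hU
  have : IsProbabilityMeasure (P.map X) := Measure.isProbabilityMeasure_map hX
  have hq : AEMeasurable (quantile (P.map X)) (P.map U) := by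
    rw [hmap]
    exact aemeasurable_quantile
  refine ⟨hq.comp_aemeasurable hUm, hX, ?_⟩
  have h := AEMeasurable.map_map_of_aemeasurable hq hUm
  rw [hmap, map_quantile ((ae_map_iff hX measurableSet_Ici).2 hX0)] at h
  exact h.symm

end Uniform

/-! ### Comonotonic vectors minimize submodular expectations -/

section Comonotonic

variable {Ω ι : Type*} [MeasurableSpace Ω] {P : Measure Ω} {U : Ω → ℝ} {f : (ι → ℝ) → ℝ}
  {q : ι → ℝ → ℝ} {X : Ω → ι → ℝ}

lemma measureReal_preimage_Ico_of_isUniform (hU : pdf.IsUniform U (Icc 0 1) P volume) {m k : ℕ}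
    (hk : k < m) : P.real (U ⁻¹' Ico ((k : ℝ) / m) ((k + 1) / m)) = 1 / m := by
  have hm : (0 : ℝ) < m := by exact_mod_cast (Nat.zero_le k).trans_lt hk
  rw [measureReal_def, ← Measure.map_apply_of_aemeasurable (aemeasurable_of_isUniform hU)
    measurableSet_Ico, isUniform_Icc_iff.1 hU, Measure.restrict_apply measurableSet_Ico,
    inter_eq_left.2, Real.volume_Ico, ENNReal.toReal_ofReal]
  · ring
  · rw [sub_nonneg]
    gcongr
    linarith
  · intro u hu
    have h1 : ((k : ℝ) + 1) / m ≤ 1 := by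
      rw [div_le_one hm]
      exact_mod_cast hk
    exact ⟨le_trans (by positivity) hu.1, hu.2.le.trans h1⟩

/-- Truncated values of a curve along the uniform grid with `m` cells. -/
def gridCurve (q : ι → ℝ → ℝ) (K : ℝ) (m k : ℕ) (j : ι) : ℝ :=
  if k = 0 then 0 else if k < m then min (q j (k / m)) K else K

lemma monotone_gridCurve (hq : ∀ j, MonotoneOn (q j) (Iio 1)) (hq0 : ∀ j u, 0 ≤ q j u) {K : ℝ}
    (hK : 0 ≤ K) (m : ℕ) : Monotone (gridCurve q K m) := by
  refine monotone_nat_of_le_succ fun k j => ?_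
  simp only [gridCurve]
  rw [if_neg k.succ_ne_zero]
  by_cases hk : k + 1 < m
  · rw [if_pos hk]
    have hm : (0 : ℝ) < m := by exact_mod_cast (Nat.zero_le _).trans_lt hk
    split_ifs with h1 h2
    · exact le_min (hq0 _ _) hK
    · refine min_le_min_right _ (hq j ?_ ?_ ?_)
      · rw [mem_Iio, div_lt_one hm]
        exact_mod_cast h2
      · rw [mem_Iio, div_lt_one hm]
        exact_mod_cast hk
      · push_cast
        gcongr
        linarith
    · omega
  · rw [if_neg hk]
    split_ifs with h1 h2
    · exact hK
    · exact min_le_right _ _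
    · exact le_rfl

lemma gridCurve_le (hq : ∀ j, MonotoneOn (q j) (Iio 1)) (hq0 : ∀ j u, 0 ≤ q j u) {K : ℝ}
    (hK : 0 ≤ K) {m k : ℕ} {u : ℝ} (hkm : k < m) (hu : u < 1) (hk : k / m ≤ u) (j : ι) :
    gridCurve q K m k j ≤ min (q j u) K := by
  rw [gridCurve]
  split_ifs with h
  · exact le_min (hq0 _ _) hK
  · exact min_le_min_right _ (hq j (hk.trans_lt hu) hu hk)

lemma le_gridCurve (hq : ∀ j, MonotoneOn (q j) (Iio 1)) {K : ℝ} {m k : ℕ} {u : ℝ} (hu : u < 1)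
    (hk : u ≤ (k + 1) / m) (j : ι) : min (q j u) K ≤ gridCurve q K m (k + 1) j := by
  rw [gridCurve, if_neg k.succ_ne_zero]
  split_ifs with h
  · have hm : (0 : ℝ) < m := by exact_mod_cast (Nat.zero_le _).trans_lt h
    push_cast
    refine min_le_min_right _ (hq j hu ?_ hk)
    rw [mem_Iio, div_lt_one hm]
    exact_mod_cast h
  · exact min_le_right _ _

variable [Fintype ι] [IsProbabilityMeasure P]

/-- The separable minorant of the grid chain from `0` to `(K, …, K)` has the same mean at `X` and at
`q(U)`. On cell `k` the truncated curve lies below `z (k + 1)`, so there `f` exceeds `f 0` plus the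
minorant by at most `f (z (k + 1)) - f (z k)`. Cells have mass `1 / m`, and the errors telescope. -/
lemma IsMonoSubmodular.integral_trunc_le_add (hf : IsMonoSubmodular f)
    (hU : pdf.IsUniform U (Icc 0 1) P volume) (hX : ∀ j, Integrable (fun ω => X ω j) P)
    (hX0 : ∀ j, ∀ᵐ ω ∂P, 0 ≤ X ω j)
    (hq : ∀ j, MonotoneOn (q j) (Iio 1)) (hq0 : ∀ j u, 0 ≤ q j u)
    (hqX : ∀ j, IdentDistrib (fun ω => q j (U ω)) (fun ω => X ω j) P P) {K : ℝ} (hK : 0 ≤ K)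
    {m : ℕ} (hm : 0 < m) :
    ∫ ω, f (fun j => min (q j (U ω)) K) ∂P
      ≤ ∫ ω, f (fun j => min (X ω j) K) ∂P + (f (fun _ => K) - f 0) / m := by
  have hm' : (0 : ℝ) < m := by exact_mod_cast hm
  set z := gridCurve q K m with hz
  have hzmono : Monotone z := monotone_gridCurve hq hq0 hK m
  have hz0 : z 0 = 0 := by
    funext j
    simp [hz, gridCurve]
  have hzm : z m = fun _ => K := by
    funext j
    simp [hz, gridCurve, hm.ne']
  obtain ⟨h, hmono, h0, hb, hle, heq⟩ := hf.exists_potential hzmono m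
  have hnn : ∀ j y, 0 ≤ h j y := fun j y => by
    rw [← h0 j _ (min_le_right y (z 0 j))]
    exact hmono j (min_le_left _ _)
  have hbd : ∀ j y, h j y ≤ h j (z m j) := fun j y => by
    rw [← hb j _ (le_max_right y (z m j))]
    exact hmono j (le_max_left _ _)
  have hint : ∀ (j : ι) (Y : Ω → ℝ), AEMeasurable Y P → Integrable (fun ω => h j (Y ω)) P :=
    fun j Y hY => Integrable.of_bound
      ((hmono j).measurable.comp_aemeasurable hY).aestronglyMeasurable (h j (z m j))
      (ae_of_all _ fun ω => by
        rw [Real.norm_eq_abs, abs_of_nonneg (hnn _ _)]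
        exact hbd _ _)
  have hqi : ∀ j, Integrable (fun ω => q j (U ω)) P := fun j => (hqX j).integrable_iff.2 (hX j)
  have hsumeq : ∫ ω, ∑ j, h j (q j (U ω)) ∂P = ∫ ω, ∑ j, h j (X ω j) ∂P := by
    rw [integral_finsetSum _ fun j _ => hint j _ (hqi j).aemeasurable,
      integral_finsetSum _ fun j _ => hint j _ (hX j).aemeasurable]
    exact Finset.sum_congr rfl fun j _ => ((hqX j).comp (hmono j).measurable).integral_eq
  have hlow : ∫ ω, ∑ j, h j (X ω j) ∂P ≤ ∫ ω, f (fun j => min (X ω j) K) ∂P - f 0 := by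
    have hXK : Integrable (fun ω => f (fun j => min (X ω j) K)) P :=
      hf.integrable_comp fun j => (hX j).inf (integrable_const K)
    have : ∫ ω, f (fun j => min (X ω j) K) ∂P - f 0
        = ∫ ω, (f (fun j => min (X ω j) K) - f 0) ∂P := by
      rw [integral_sub hXK (integrable_const _)]
      simp
    rw [this]
    refine integral_mono_ae (integrable_finsetSum _ fun j _ => hint j _ (hX j).aemeasurable)
      (hXK.sub (integrable_const _)) ?_
    filter_upwards [ae_all_iff.2 hX0] with ω hω
    have h1 := hle (X ω)
    rw [hz0, hzm, inf_eq_right.2 (show (0 : ι → ℝ) ≤ X ω from hω)] at h1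
    exact h1
  have hstep : ∀ k : ℕ, MeasurableSet (Ico ((k : ℝ) / m) ((k + 1) / m)) := fun k => measurableSet_Ico
  set d : ℕ → ℝ := fun k => f (z (k + 1)) - f (z k) with hd
  have hd0 : ∀ k, 0 ≤ d k := fun k => sub_nonneg.2 (hf.mono (hzmono k.le_succ))
  let I : ℕ → ℝ → ℝ := fun k => (Ico ((k : ℝ) / m) ((k + 1) / m)).indicator fun _ => d k
  have hUm := aemeasurable_of_isUniform hU
  have hIint : ∀ k, Integrable (fun ω => I k (U ω)) P := fun k =>
    Integrable.of_bound (((measurable_const.indicator (hstep k)).comp_aemeasurable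
      hUm).aestronglyMeasurable) (d k) (ae_of_all _ fun ω => by
        rw [Real.norm_eq_abs, abs_of_nonneg (indicator_nonneg (fun _ _ => hd0 k) _)]
        exact indicator_le_self' (fun _ _ => hd0 k) _)
  have hIeq : ∀ k < m, ∫ ω, I k (U ω) ∂P = d k / m := fun k hk => by
    have h1 : ∫ ω, I k (U ω) ∂P = ∫ u, I k u ∂P.map U :=
      (integral_map hUm (measurable_const.indicator (hstep k)).aestronglyMeasurable).symm
    rw [h1, integral_indicator (hstep k), setIntegral_const, measureReal_def,
      Measure.map_apply_of_aemeasurable hUm (hstep k), ← measureReal_def,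
      measureReal_preimage_Ico_of_isUniform hU hk, smul_eq_mul]
    ring
  have hsum1 : Integrable (fun ω => ∑ j, h j (q j (U ω))) P :=
    integrable_finsetSum _ fun j _ => hint j _ (hqi j).aemeasurable
  have hsum2 : Integrable (fun ω => ∑ j, h j (q j (U ω)) + f 0) P :=
    hsum1.add (integrable_const _)
  have hsum3 : Integrable (fun ω => ∑ k ∈ Finset.range m, I k (U ω)) P :=
    integrable_finsetSum _ fun k _ => hIint k
  have hup : ∫ ω, f (fun j => min (q j (U ω)) K) ∂P
      ≤ ∫ ω, ((∑ j, h j (q j (U ω)) + f 0) + ∑ k ∈ Finset.range m, I k (U ω)) ∂P := by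
    refine integral_mono_ae (hf.integrable_comp fun j => (hqi j).inf (integrable_const K))
      (hsum2.add hsum3) ?_
    filter_upwards [ae_mem_Ioo_of_isUniform hU] with ω hω
    set u := U ω
    -- The index of the grid cell containing `u`.
    set k := ⌊m * u⌋₊ with hk
    have hmu : 0 ≤ m * u := mul_nonneg hm'.le hω.1.le
    have hkm : k < m := by
      rw [hk, Nat.floor_lt hmu]
      nlinarith [hω.2]
    have hk1 : (k : ℝ) / m ≤ u := by
      rw [div_le_iff₀' hm']
      exact Nat.floor_le hmu
    have hk2 : u < ((k : ℝ) + 1) / m := by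
      rw [lt_div_iff₀' hm']
      exact Nat.lt_floor_add_one _
    have h1 : f (fun j => min (q j u) K) ≤ f (z (k + 1)) :=
      hf.mono fun j => le_gridCurve hq hω.2 hk2.le j
    have h2 : ∑ j, h j (z k j) ≤ ∑ j, h j (q j u) := Finset.sum_le_sum fun j _ =>
      hmono j ((gridCurve_le hq hq0 hK hkm hω.2 hk1 j).trans (min_le_left _ _))
    rw [heq k hkm.le, hz0] at h2
    have h3 : d k ≤ ∑ k ∈ Finset.range m, I k u := by
      have : d k = I k u := by
        simp only [I]
        rw [indicator_of_mem (mem_Ico.2 ⟨hk1, hk2⟩)]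
      rw [this]
      exact Finset.single_le_sum (f := fun k => I k u)
        (fun k _ => indicator_nonneg (fun _ _ => hd0 k) _) (Finset.mem_range.2 hkm)
    simp only [hd] at h3
    linarith
  rw [integral_add hsum2 hsum3, integral_add hsum1 (integrable_const _), hsumeq,
    integral_finsetSum _ fun k _ => hIint k,
    Finset.sum_congr rfl fun k hk => hIeq k (Finset.mem_range.1 hk), ← Finset.sum_div,
    Finset.sum_range_sub (fun k => f (z k)), hz0, hzm] at hup
  simp only [integral_const, probReal_univ, one_smul] at hup
  linarith

/-- Among random vectors with given margins, the comonotonic one minimizes the expectation of a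
submodular function. -/
theorem IsMonoSubmodular.integral_comonotonic_le (hf : IsMonoSubmodular f)
    (hU : pdf.IsUniform U (Icc 0 1) P volume) (hX : ∀ j, Integrable (fun ω => X ω j) P)
    (hX0 : ∀ j, ∀ᵐ ω ∂P, 0 ≤ X ω j)
    (hq : ∀ j, MonotoneOn (q j) (Iio 1)) (hq0 : ∀ j u, 0 ≤ q j u)
    (hqX : ∀ j, IdentDistrib (fun ω => q j (U ω)) (fun ω => X ω j) P P) :
    ∫ ω, f (fun j => q j (U ω)) ∂P ≤ ∫ ω, f (X ω) ∂P := by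
  have hqi : ∀ j, Integrable (fun ω => q j (U ω)) P := fun j => (hqX j).integrable_iff.2 (hX j)
  have htrunc : ∀ K : ℕ, ∫ ω, f (fun j => min (q j (U ω)) K) ∂P ≤ ∫ ω, f (X ω) ∂P := by
    intro K
    have h1 : ∫ ω, f (fun j => min (q j (U ω)) K) ∂P ≤ ∫ ω, f (fun j => min (X ω j) K) ∂P := by
      have hlim : Tendsto (fun m : ℕ => ∫ ω, f (fun j => min (X ω j) K) ∂P
          + (f (fun _ => (K : ℝ)) - f 0) / m) atTop (𝓝 (∫ ω, f (fun j => min (X ω j) K) ∂P + 0)) :=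
        tendsto_const_nhds.add (tendsto_const_div_atTop_nhds_zero_nat _)
      rw [add_zero] at hlim
      refine ge_of_tendsto hlim ((eventually_gt_atTop 0).mono fun m hm => ?_)
      exact hf.integral_trunc_le_add hU hX hX0 hq hq0 hqX K.cast_nonneg hm
    exact h1.trans (integral_mono (hf.integrable_comp fun j => (hX j).inf (integrable_const _))
      (hf.integrable_comp hX) fun ω => hf.mono fun j => min_le_left _ _)
  -- Dominated convergence: by monotonicity the truncated values lie between `f 0` and `f (q(U))`.
  have hlim : Tendsto (fun K : ℕ => ∫ ω, f (fun j => min (q j (U ω)) K) ∂P) atTop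
      (𝓝 (∫ ω, f (fun j => q j (U ω)) ∂P)) := by
    refine tendsto_integral_of_dominated_convergence
      (fun ω => |f 0| + |f (fun j => q j (U ω))|)
      (fun K => (hf.integrable_comp fun j =>
        (hqi j).inf (integrable_const (K : ℝ))).aestronglyMeasurable)
      ((integrable_const _).add (hf.integrable_comp hqi).abs) (fun K => ae_of_all _ fun ω => ?_)
      (ae_of_all _ fun ω => ?_)
    · have h1 : f 0 ≤ f (fun j => min (q j (U ω)) K) :=
        hf.mono fun j => le_min (hq0 _ _) K.cast_nonneg
      have h2 : f (fun j => min (q j (U ω)) K) ≤ f (fun j => q j (U ω)) :=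
        hf.mono fun j => min_le_left _ _
      rw [Real.norm_eq_abs, abs_le]
      constructor
      · linarith [neg_abs_le (f 0), abs_nonneg (f (fun j => q j (U ω)))]
      · linarith [le_abs_self (f (fun j => q j (U ω))), abs_nonneg (f 0)]
    · refine (hf.continuous.tendsto _).comp (tendsto_pi_nhds.2 fun j => ?_)
      refine tendsto_const_nhds.congr' ?_
      filter_upwards [eventually_ge_atTop ⌈q j (U ω)⌉₊] with K hK
      exact (min_eq_left (Nat.ceil_le.1 hK)).symm
  exact le_of_tendsto hlim (Eventually.of_forall htrunc)

end Comonotonic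

end

/-! ### Simultaneous halving of finitely many measures -/

noncomputable section

open Filter Topology Set

section Halving

variable {Ω : Type*}

/-- Every event can be split into two parts which have equal mass under all measures of `M`. -/
def Halvable [MeasurableSpace Ω] (M : Set (Measure Ω)) : Prop :=
  ∀ A, MeasurableSet A → ∃ B ⊆ A, MeasurableSet B ∧ ∀ μ ∈ M, μ.real B = μ.real A / 2

/-- The dyadic chain of events generated from `A` by a halving rule `H`. -/
def dyadicChain (H : Set Ω → Set Ω) (A : Set Ω) : ℕ → ℕ → Set Ω
  | 0, k => if k = 0 then ∅ else A
  | n + 1, k => if k % 2 = 0 then dyadicChain H A n (k / 2) else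
      dyadicChain H A n (k / 2) ∪ H (dyadicChain H A n (k / 2 + 1) \ dyadicChain H A n (k / 2))

variable {H : Set Ω → Set Ω} {A : Set Ω}

lemma dyadicChain_even (n k : ℕ) : dyadicChain H A (n + 1) (2 * k) = dyadicChain H A n k := by
  rw [dyadicChain, if_pos (by omega), Nat.mul_div_cancel_left k two_pos]

lemma dyadicChain_odd (n k : ℕ) : dyadicChain H A (n + 1) (2 * k + 1) = dyadicChain H A n k ∪
    H (dyadicChain H A n (k + 1) \ dyadicChain H A n k) := by
  rw [dyadicChain, if_neg (by omega), show (2 * k + 1) / 2 = k by omega]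

lemma dyadicChain_refine (n r k : ℕ) :
    dyadicChain H A (n + r) (2 ^ r * k) = dyadicChain H A n k := by
  induction r with
  | zero => simp
  | succ r ih => rw [← add_assoc, pow_succ', mul_assoc, dyadicChain_even, ih]

lemma dyadicChain_pow (n : ℕ) : dyadicChain H A n (2 ^ n) = A := by
  have := dyadicChain_refine (H := H) (A := A) 0 n 1
  simpa [dyadicChain] using this

open Classical in
/-- The function equal to `c` on `C` and to `1` elsewhere. -/
def cappedLevel (C : Set Ω) (c : ℝ) (ω : Ω) : ℝ := if ω ∈ C then c else 1

lemma cappedLevel_of_mem {C : Set Ω} {c : ℝ} {ω : Ω} (h : ω ∈ C) : cappedLevel C c ω = c :=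
  if_pos h

lemma cappedLevel_of_notMem {C : Set Ω} {c : ℝ} {ω : Ω} (h : ω ∉ C) : cappedLevel C c ω = 1 :=
  if_neg h

lemma cappedLevel_nonneg {C : Set Ω} {c : ℝ} (hc : 0 ≤ c) (ω : Ω) : 0 ≤ cappedLevel C c ω := by
  rw [cappedLevel]
  split_ifs
  exacts [hc, zero_le_one]

/-- The position of a point in the dyadic chain. -/
def dyadicRank (H : Set Ω → Set Ω) (A : Set Ω) (ω : Ω) : ℝ :=
  ⨅ p : ℕ × ℕ, cappedLevel (dyadicChain H A p.1 p.2) ((p.2 : ℝ) / 2 ^ p.1) ω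

lemma bddBelow_range_cappedLevel (ω : Ω) : BddBelow (range fun p : ℕ × ℕ =>
    cappedLevel (dyadicChain H A p.1 p.2) ((p.2 : ℝ) / 2 ^ p.1) ω) := by
  refine ⟨0, ?_⟩
  rintro _ ⟨p, rfl⟩
  exact cappedLevel_nonneg (by positivity) ω

lemma dyadicRank_nonneg (ω : Ω) : 0 ≤ dyadicRank H A ω :=
  Real.iInf_nonneg fun _ => cappedLevel_nonneg (by positivity) ω

lemma dyadicRank_le {n k : ℕ} {ω : Ω} (h : ω ∈ dyadicChain H A n k) :
    dyadicRank H A ω ≤ k / 2 ^ n :=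
  (ciInf_le (bddBelow_range_cappedLevel ω) (n, k)).trans_eq (cappedLevel_of_mem h)

lemma dyadicRank_le_one (ω : Ω) : dyadicRank H A ω ≤ 1 :=
  (ciInf_le (bddBelow_range_cappedLevel ω) (0, 0)).trans_eq
    (cappedLevel_of_notMem (by simp [dyadicChain]))

variable [MeasurableSpace Ω]

lemma measurableSet_dyadicChain (hA : MeasurableSet A)
    (hH : ∀ A, MeasurableSet A → MeasurableSet (H A)) (n k : ℕ) :
    MeasurableSet (dyadicChain H A n k) := by
  induction n generalizing k with
  | zero =>
    rw [dyadicChain]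
    split_ifs
    exacts [MeasurableSet.empty, hA]
  | succ n ih =>
    rw [dyadicChain]
    split_ifs
    exacts [ih _, (ih _).union (hH _ ((ih _).diff (ih _)))]

lemma monotone_dyadicChain (hA : MeasurableSet A)
    (hH : ∀ A, MeasurableSet A → MeasurableSet (H A))
    (hHsub : ∀ A, MeasurableSet A → H A ⊆ A) (n : ℕ) : Monotone (dyadicChain H A n) := by
  induction n with
  | zero =>
    refine monotone_nat_of_le_succ fun k => ?_
    simp only [dyadicChain]
    split_ifs <;> simp_all
  | succ n ih =>
    refine monotone_nat_of_le_succ fun k => ?_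
    have hm := measurableSet_dyadicChain hA hH n
    obtain ⟨l, rfl | rfl⟩ := k.even_or_odd'
    · rw [dyadicChain_even, dyadicChain_odd]
      exact subset_union_left
    · rw [show 2 * l + 1 + 1 = 2 * (l + 1) by ring, dyadicChain_even, dyadicChain_odd]
      exact union_subset (ih l.le_succ)
        ((hHsub _ ((hm _).diff (hm _))).trans sdiff_subset)

lemma measureReal_dyadicChain (hA : MeasurableSet A)
    (hH : ∀ A, MeasurableSet A → MeasurableSet (H A))
    (hHsub : ∀ A, MeasurableSet A → H A ⊆ A) {μ : Measure Ω} [IsFiniteMeasure μ]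
    (hμ : ∀ A, MeasurableSet A → μ.real (H A) = μ.real A / 2) (n k : ℕ) (hk : k ≤ 2 ^ n) :
    μ.real (dyadicChain H A n k) = k / 2 ^ n * μ.real A := by
  induction n generalizing k with
  | zero =>
    rw [pow_zero] at hk
    rw [dyadicChain]
    interval_cases k <;> simp
  | succ n ih =>
    have hm := measurableSet_dyadicChain hA hH n
    obtain ⟨l, rfl | rfl⟩ := k.even_or_odd'
    · rw [dyadicChain_even, ih l (by rw [pow_succ] at hk; omega)]
      push_cast
      ring
    · have hl : l + 1 ≤ 2 ^ n := by rw [pow_succ] at hk; omega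
      have hd := (hm (l + 1)).diff (hm l)
      rw [dyadicChain_odd, measureReal_union (disjoint_sdiff_right.mono_right (hHsub _ hd))
        (hH _ hd), hμ _ hd,
        measureReal_sdiff (monotone_dyadicChain hA hH hHsub n l.le_succ) (hm l),
        ih l (by omega), ih _ hl]
      push_cast
      field_simp
      ring

/-- Both sets reappear at the common level `n + n'`, where the chain is monotone. -/
lemma dyadicChain_subset (hA : MeasurableSet A)
    (hH : ∀ A, MeasurableSet A → MeasurableSet (H A))
    (hHsub : ∀ A, MeasurableSet A → H A ⊆ A) {n k n' k' : ℕ}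
    (h : (k : ℝ) / 2 ^ n ≤ k' / 2 ^ n') : dyadicChain H A n k ⊆ dyadicChain H A n' k' := by
  rw [← dyadicChain_refine n n' k, ← dyadicChain_refine n' n k', add_comm n' n]
  refine monotone_dyadicChain hA hH hHsub _ ?_
  rw [div_le_div_iff₀ (by positivity) (by positivity)] at h
  have h' : k * 2 ^ n' ≤ k' * 2 ^ n := by exact_mod_cast h
  rwa [mul_comm, mul_comm (2 ^ n)]

lemma mem_of_dyadicRank_lt (hA : MeasurableSet A)
    (hH : ∀ A, MeasurableSet A → MeasurableSet (H A))
    (hHsub : ∀ A, MeasurableSet A → H A ⊆ A) {n k : ℕ} (hk : k ≤ 2 ^ n) {ω : Ω}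
    (h : dyadicRank H A ω < k / 2 ^ n) : ω ∈ dyadicChain H A n k := by
  obtain ⟨p, hp⟩ := exists_lt_of_ciInf_lt h
  by_cases hω : ω ∈ dyadicChain H A p.1 p.2
  · rw [cappedLevel_of_mem hω] at hp
    exact dyadicChain_subset hA hH hHsub hp.le hω
  · rw [cappedLevel_of_notMem hω, lt_div_iff₀ (by positivity), one_mul] at hp
    have : (k : ℝ) ≤ 2 ^ n := by exact_mod_cast hk
    linarith

lemma measurable_dyadicRank (hA : MeasurableSet A)
    (hH : ∀ A, MeasurableSet A → MeasurableSet (H A)) : Measurable (dyadicRank H A) :=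
  Measurable.iInf fun _ =>
    Measurable.ite (measurableSet_dyadicChain hA hH _ _) measurable_const measurable_const

/-- At level `n` the sublevel set is squeezed between the chain sets with indices `⌊2 ^ n * t⌋` and
its successor, whose masses differ by `μ(A) / 2 ^ n`. -/
lemma measureReal_dyadicRank_le (hA : MeasurableSet A)
    (hH : ∀ A, MeasurableSet A → MeasurableSet (H A))
    (hHsub : ∀ A, MeasurableSet A → H A ⊆ A) {μ : Measure Ω} [IsFiniteMeasure μ]
    (hμ : ∀ A, MeasurableSet A → μ.real (H A) = μ.real A / 2) {t : ℝ} (ht : t ∈ Ico (0 : ℝ) 1) :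
    μ.real (dyadicRank H A ⁻¹' Iic t ∩ A) = t * μ.real A := by
  have hmono := monotone_dyadicChain hA hH hHsub
  have hsub : ∀ n k, k ≤ 2 ^ n → dyadicChain H A n k ⊆ A := fun n k hk =>
    (hmono n hk).trans_eq (dyadicChain_pow n)
  have hbound : ∀ n : ℕ, |μ.real (dyadicRank H A ⁻¹' Iic t ∩ A) - t * μ.real A|
      ≤ μ.real A * (1 / 2) ^ n := by
    intro n
    have h2 : (0 : ℝ) < 2 ^ n := by positivity
    have hnn : 0 ≤ 2 ^ n * t := mul_nonneg h2.le ht.1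
    set k := ⌊2 ^ n * t⌋₊ with hk
    have hk1 : (k : ℝ) ≤ 2 ^ n * t := Nat.floor_le hnn
    have hk2 : 2 ^ n * t < k + 1 := Nat.lt_floor_add_one _
    have hlt : k < 2 ^ n := by
      rw [hk, Nat.floor_lt hnn]
      push_cast
      nlinarith [ht.2]
    have hlow : k / 2 ^ n * μ.real A ≤ μ.real (dyadicRank H A ⁻¹' Iic t ∩ A) := by
      rw [← measureReal_dyadicChain hA hH hHsub hμ n k hlt.le]
      refine measureReal_mono fun ω hω => ⟨?_, hsub n k hlt.le hω⟩
      exact (dyadicRank_le hω).trans (by rwa [div_le_iff₀' h2])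
    have hupp : μ.real (dyadicRank H A ⁻¹' Iic t ∩ A) ≤ ((k + 1 : ℕ) : ℝ) / 2 ^ n * μ.real A := by
      rw [← measureReal_dyadicChain hA hH hHsub hμ n (k + 1) hlt]
      refine measureReal_mono fun ω hω => mem_of_dyadicRank_lt hA hH hHsub hlt ?_
      refine (mem_Iic.1 hω.1).trans_lt ?_
      rw [lt_div_iff₀' h2]
      exact_mod_cast hk2
    have hA0 : 0 ≤ μ.real A := measureReal_nonneg
    have e1 : t - (1 / 2) ^ n ≤ k / 2 ^ n := by
      rw [le_div_iff₀ h2, sub_mul, ← mul_pow]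
      norm_num
      linarith
    have e2 : ((k + 1 : ℕ) : ℝ) / 2 ^ n ≤ t + (1 / 2) ^ n := by
      rw [div_le_iff₀ h2, add_mul, ← mul_pow]
      push_cast
      norm_num
      linarith
    have e3 := mul_le_mul_of_nonneg_right e1 hA0
    have e4 := mul_le_mul_of_nonneg_right e2 hA0
    rw [abs_le]
    constructor <;> linarith
  have hlim : Tendsto (fun n : ℕ => μ.real A * (1 / 2 : ℝ) ^ n) atTop (𝓝 (μ.real A * 0)) :=
    (tendsto_pow_atTop_nhds_zero_of_lt_one (by norm_num) (by norm_num)).const_mul _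
  rw [mul_zero] at hlim
  have := ge_of_tendsto hlim (Eventually.of_forall hbound)
  exact sub_eq_zero.1 (abs_eq_zero.1 (le_antisymm this (abs_nonneg _)))

/-- One halving rule serves all measures of `M`, so the rank in its dyadic chain is uniform under
all of them at once. -/
lemma Halvable.exists_uniform {M : Set (Measure Ω)} (hM : Halvable M)
    (hfin : ∀ μ ∈ M, IsFiniteMeasure μ) (hA : MeasurableSet A) :
    ∃ W : Ω → ℝ, Measurable W ∧
      ∀ μ ∈ M, (μ.restrict A).map W = μ A • volume.restrict (Icc (0 : ℝ) 1) := by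
  choose! H hHsub hH hHμ using hM
  refine ⟨dyadicRank H A, measurable_dyadicRank hA hH, fun μ hμ => ?_⟩
  have := hfin μ hμ
  have hmeas := measurable_dyadicRank hA hH
  refine Measure.ext_of_Iic _ _ fun t => ?_
  rw [Measure.map_apply hmeas measurableSet_Iic, Measure.restrict_apply (hmeas measurableSet_Iic),
    Measure.smul_apply, Measure.restrict_apply measurableSet_Iic, smul_eq_mul]
  rcases lt_or_ge t 0 with ht0 | ht0
  · have h1 : dyadicRank H A ⁻¹' Iic t ∩ A = ∅ := by
      ext ω
      simpa using fun h => absurd (dyadicRank_nonneg (H := H) (A := A) ω)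
        (not_le.2 (lt_of_le_of_lt h ht0))
    have h2 : Iic t ∩ Icc (0 : ℝ) 1 = ∅ := by
      ext u
      simp only [mem_inter_iff, mem_Iic, mem_Icc, mem_empty_iff_false, iff_false]
      exact fun h => absurd (h.2.1.trans h.1) (not_le.2 ht0)
    simp [h1, h2]
  rcases lt_or_ge t 1 with ht1 | ht1
  · have h := measureReal_dyadicRank_le hA hH hHsub (fun A hA => hHμ A hA μ hμ) ⟨ht0, ht1⟩
    have h2 : Iic t ∩ Icc (0 : ℝ) 1 = Icc 0 t := by
      ext u
      simp only [mem_inter_iff, mem_Iic, mem_Icc]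
      exact ⟨fun h => ⟨h.2.1, h.1⟩, fun h => ⟨h.2, h.1, h.2.trans ht1.le⟩⟩
    rw [h2, Real.volume_Icc, sub_zero, ← ofReal_measureReal, h, ENNReal.ofReal_mul ht0,
      ofReal_measureReal, mul_comm]
  · have h1 : dyadicRank H A ⁻¹' Iic t ∩ A = A :=
      inter_eq_right.2 fun ω _ => (dyadicRank_le_one ω).trans ht1
    have h2 : Iic t ∩ Icc (0 : ℝ) 1 = Icc 0 1 :=
      inter_eq_right.2 fun u hu => hu.2.trans ht1
    simp [h1, h2]

/-- The law of `W` has no atoms, so the mass of the window depends continuously on `s`. The windows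
at `s = 0` and `s = 1 / 2` share the total mass, so one has at least half and the other at most
half. -/
lemma exists_halving_window {ν : Measure Ω} [IsFiniteMeasure ν] {W : Ω → ℝ} (hW : Measurable W)
    (hν : (ν.restrict A).map W ≪ volume.restrict (Icc (0 : ℝ) 1)) :
    ∃ s ∈ Icc (0 : ℝ) (1 / 2), ν.real (W ⁻¹' Ioc s (s + 1 / 2) ∩ A) = ν.real A / 2 := by
  set ρ := (ν.restrict A).map W with hρ
  have : NullSingletonClass ρ := ⟨fun x => (hν.trans Measure.absolutelyContinuous_restrict)
    (measure_singleton x)⟩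
  have hpre : ∀ S, MeasurableSet S → ρ.real S = ν.real (W ⁻¹' S ∩ A) := fun S hS => by
    rw [measureReal_def, hρ, Measure.map_apply hW hS, Measure.restrict_apply (hW hS),
      measureReal_def]
  have hint : ∀ a b : ℝ, IntervalIntegrable (fun _ => (1 : ℝ)) ρ a b := fun a b =>
    intervalIntegrable_const
  set F : ℝ → ℝ := fun b => ∫ _ in (0 : ℝ)..b, (1 : ℝ) ∂ρ with hF
  have hFc : Continuous F := intervalIntegral.continuous_primitive hint 0
  have hFsub : ∀ a b, a ≤ b → F b - F a = ρ.real (Ioc a b) := fun a b hab => by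
    rw [hF, intervalIntegral.integral_interval_sub_left (hint _ _) (hint _ _),
      intervalIntegral.integral_of_le hab]
    simp
  have htot : F 1 - F 0 = ν.real A := by
    rw [hFsub 0 1 zero_le_one]
    have h0 : ρ (Ioc (0 : ℝ) 1)ᶜ = 0 := by
      refine hν ?_
      rw [← Measure.restrict_congr_set (Ioc_ae_eq_Icc (a := (0 : ℝ)) (b := 1)),
        Measure.restrict_apply measurableSet_Ioc.compl, compl_inter_self, measure_empty]
    have h1 : ρ.real (Ioc 0 1) = ρ.real univ := by
      rw [measureReal_def, measureReal_def, measure_eq_measure_of_null_sdiff (subset_univ _)]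
      rwa [← compl_eq_univ_sdiff]
    rw [h1, hpre _ MeasurableSet.univ, preimage_univ, univ_inter]
  have hc : ContinuousOn (fun s => F (s + 1 / 2) - F s) (uIcc 0 (1 / 2)) := by
    fun_prop
  have hmem : ν.real A / 2 ∈ uIcc (F (0 + 1 / 2) - F 0) (F (1 / 2 + 1 / 2) - F (1 / 2)) := by
    rw [mem_uIcc]
    norm_num
    rcases le_total (F (1 / 2) - F 0) (F 1 - F (1 / 2)) with h | h
    · left
      constructor <;> linarith
    · right
      constructor <;> linarith
  obtain ⟨s, hs, hs'⟩ := intermediate_value_uIcc hc hmem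
  rw [uIcc_of_le (by norm_num)] at hs
  refine ⟨s, hs, ?_⟩
  rw [← hs', ← hpre _ measurableSet_Ioc]
  exact (hFsub s (s + 1 / 2) (by linarith)).symm

lemma halvable_singleton {P : Measure Ω} [IsProbabilityMeasure P] {U : Ω → ℝ}
    (hU : Measurable U) (hunif : pdf.IsUniform U (Icc 0 1) P volume) : Halvable {P} := by
  intro A hA
  have hac : (P.restrict A).map U ≪ volume.restrict (Icc (0 : ℝ) 1) := by
    rw [← isUniform_Icc_iff.1 hunif]
    exact (Measure.absolutelyContinuous_of_le Measure.restrict_le_self).map hU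
  obtain ⟨s, -, hs⟩ := exists_halving_window hU hac
  refine ⟨U ⁻¹' Ioc s (s + 1 / 2) ∩ A, inter_subset_right, (hU measurableSet_Ioc).inter hA, ?_⟩
  rintro _ rfl
  exact hs

/-- Take `W` uniform on `A` under all of `M`. Every window of length `1 / 2` inside `[0, 1]` halves
the old measures, and `s` remains free to halve `ν` as well. Absolute continuity excludes atoms of
the law of `W` under `ν`. -/
lemma Halvable.insert {M : Set (Measure Ω)} (hM : Halvable M)
    (hfin : ∀ μ ∈ M, IsFiniteMeasure μ) {P ν : Measure Ω} [IsFiniteMeasure ν] (hP : P ∈ M)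
    (hν : ν ≪ P) : Halvable (insert ν M) := by
  intro A hA
  obtain ⟨W, hW, hWM⟩ := hM.exists_uniform hfin hA
  have hac : (ν.restrict A).map W ≪ volume.restrict (Icc (0 : ℝ) 1) := by
    refine ((hν.restrict A).map hW).trans ?_
    rw [hWM P hP]
    exact Measure.smul_absolutelyContinuous
  obtain ⟨s, hs, hsν⟩ := exists_halving_window hW hac
  refine ⟨W ⁻¹' Ioc s (s + 1 / 2) ∩ A, inter_subset_right, (hW measurableSet_Ioc).inter hA, ?_⟩
  rintro μ (rfl | hμ)
  · exact hsν
  · have h1 := congrArg (fun ρ : Measure ℝ => ρ (Ioc s (s + 1 / 2))) (hWM μ hμ)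
    have h2 : Ioc s (s + 1 / 2) ∩ Icc (0 : ℝ) 1 = Ioc s (s + 1 / 2) :=
      inter_eq_left.2 fun u hu => ⟨hs.1.trans hu.1.le, hu.2.trans (by linarith [hs.2])⟩
    simp only [Measure.map_apply hW measurableSet_Ioc,
      Measure.restrict_apply (hW measurableSet_Ioc), Measure.smul_apply,
      Measure.restrict_apply measurableSet_Ioc, h2, Real.volume_Ioc, smul_eq_mul,
      add_sub_cancel_left] at h1
    rw [measureReal_def, h1, ENNReal.toReal_mul, ENNReal.toReal_ofReal (by norm_num),
      measureReal_def]
    ring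

lemma halvable_union {P : Measure Ω} [IsFiniteMeasure P] (hP : Halvable {P})
    {M : Set (Measure Ω)} (hM : M.Finite) (hfin : ∀ μ ∈ M, IsFiniteMeasure μ)
    (hac : ∀ μ ∈ M, μ ≪ P) : Halvable (M ∪ {P}) := by
  induction M, hM using Set.Finite.induction_on with
  | empty => simpa using hP
  | @insert ν M _ _ ih =>
    have := hfin ν (mem_insert _ _)
    rw [insert_union]
    refine (ih (fun μ hμ => hfin μ (mem_insert_of_mem _ hμ))
      fun μ hμ => hac μ (mem_insert_of_mem _ hμ)).insert ?_ (mem_union_right _ rfl)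
      (hac ν (mem_insert _ _))
    rintro μ (hμ | rfl)
    exacts [hfin μ (mem_insert_of_mem _ hμ), inferInstance]

end Halving

/-! ### A uniform variable with constant conditional mean -/

section MeanPreserving

variable {Ω : Type*} [MeasurableSpace Ω] {P : Measure Ω} [IsProbabilityMeasure P] {n : ℕ}
  {X : Ω → Fin n → ℝ} {U : Ω → ℝ}

/-- On a space carrying a uniform random variable there is a uniform random variable `W` for which
`E[X | W]` is constant. -/
lemma exists_isUniform_condMean_const (hX : ∀ i, Integrable (fun ω => X ω i) P)
    (hX0 : ∀ i, ∀ᵐ ω ∂P, 0 ≤ X ω i) (hU : pdf.IsUniform U (Icc 0 1) P volume) :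
    ∃ W : Ω → ℝ, Measurable W ∧ pdf.IsUniform W (Icc 0 1) P volume ∧
      condMean P X W =ᵐ[P] fun _ i => ∫ ω, X ω i ∂P := by
  have hUm := aemeasurable_of_isUniform hU
  have hU' : pdf.IsUniform (hUm.mk U) (Icc 0 1) P volume := by
    rw [isUniform_Icc_iff, ← isUniform_Icc_iff.1 hU]
    exact Measure.map_congr hUm.ae_eq_mk.symm
  -- If `W` is uniform under `P` and, up to mass, under `μ i`, then `E[X i; W ∈ S] = E[X i] * P(W ∈
  -- S)`, which says that the conditional mean is constant.
  let μ : Fin n → Measure Ω := fun i => P.withDensity fun ω => ENNReal.ofReal (X ω i)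
  have hμfin : ∀ i, IsFiniteMeasure (μ i) := fun i =>
    isFiniteMeasure_withDensity_ofReal (hX i).2
  have hhalv : Halvable (range μ ∪ {P}) :=
    halvable_union (halvable_singleton hUm.measurable_mk hU') (finite_range μ)
      (by rintro _ ⟨i, rfl⟩; exact hμfin i)
      (by rintro _ ⟨i, rfl⟩; exact withDensity_absolutelyContinuous _ _)
  obtain ⟨W, hW, hWμ⟩ := hhalv.exists_uniform
    (by rintro _ (⟨i, rfl⟩ | rfl); exacts [hμfin i, inferInstance]) MeasurableSet.univ
  simp only [Measure.restrict_univ] at hWμ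
  have hPW : P.map W = volume.restrict (Icc 0 1) := by
    rw [hWμ P (mem_union_right _ rfl), measure_univ, one_smul]
  refine ⟨W, hW, isUniform_Icc_iff.2 hPW, ?_⟩
  have hint : ∀ i S, MeasurableSet S → ∫ ω in S, X ω i ∂P = (μ i).real S := fun i S hS => by
    rw [integral_eq_lintegral_of_nonneg_ae (ae_restrict_of_ae (hX0 i))
      (hX i).aestronglyMeasurable.restrict, measureReal_def, withDensity_apply _ hS]
  have hcond : ∀ i, (fun _ => ∫ ω, X ω i ∂P)
      =ᵐ[P] P[fun ω => X ω i | MeasurableSpace.comap W inferInstance] := by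
    intro i
    refine ae_eq_condExp_of_forall_setIntegral_eq hW.comap_le (hX i)
      (fun _ _ _ => (integrable_const _).integrableOn) ?_
      (stronglyMeasurable_const.aestronglyMeasurable)
    rintro _ ⟨S, hS, rfl⟩ -
    have h1 := congrArg (fun ρ : Measure ℝ => ρ.real S) (hWμ (μ i) (mem_union_left _ ⟨i, rfl⟩))
    simp only [← hPW, measureReal_def, Measure.smul_apply, smul_eq_mul, ENNReal.toReal_mul,
      Measure.map_apply hW hS] at h1
    simp only [← measureReal_def] at h1
    rw [setIntegral_const, hint i _ (hW hS), h1, ← hint i _ MeasurableSet.univ,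
      Measure.restrict_univ, smul_eq_mul, mul_comm]
  filter_upwards [ae_all_iff.2 hcond] with ω hω
  funext i
  exact (hω i).symm

lemma comonotonicFactors_nonempty (hX : ∀ i, Integrable (fun ω => X ω i) P)
    (hX0 : ∀ i, ∀ᵐ ω ∂P, 0 ≤ X ω i) (hU : pdf.IsUniform U (Icc 0 1) P volume) :
    (comonotonicFactors P X).Nonempty := by
  obtain ⟨W, hW, hunif, hae⟩ := exists_isUniform_condMean_const hX hX0 hU
  refine ⟨W, hW, hunif, 0, measurable_const, fun _ i => ∫ ω, X ω i ∂P, monotone_const, ?_⟩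
  exact (IdentDistrib.of_ae_eq aemeasurable_const hae.symm).symm

end MeanPreserving

end

/-! ### Jensen inequalities for clearing wealths and payments -/

noncomputable section

open Filter Topology Set

namespace FinancialNetwork

variable {n : ℕ} {N : FinancialNetwork n} {Ω : Type*} {m₀ : MeasurableSpace Ω} {P : Measure Ω}
  {X : Ω → Fin n → ℝ}

lemma wealth_ae_eq (hX0 : ∀ i, ∀ᵐ ω ∂P, 0 ≤ X ω i) (i : Fin n) :
    (fun ω => N.wealth 1 1 (X ω ⊔ 0) i) =ᵐ[P] fun ω => N.wealth 1 1 (X ω) i := by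
  filter_upwards [ae_all_iff.2 hX0] with ω hω
  rw [sup_eq_left.2 (show (0 : Fin n → ℝ) ≤ X ω from hω)]

lemma payment_ae_eq (hX0 : ∀ i, ∀ᵐ ω ∂P, 0 ≤ X ω i) (i : Fin n) :
    (fun ω => N.payment 1 1 (X ω ⊔ 0) i) =ᵐ[P] fun ω => N.payment 1 1 (X ω) i := by
  filter_upwards [ae_all_iff.2 hX0] with ω hω
  rw [sup_eq_left.2 (show (0 : Fin n → ℝ) ≤ X ω from hω)]

variable [IsProbabilityMeasure P]

lemma OwesSociety.integrable_wealth (hN : N.OwesSociety)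
    (hX : ∀ i, Integrable (fun ω => X ω i) P) (hX0 : ∀ i, ∀ᵐ ω ∂P, 0 ≤ X ω i) (i : Fin n) :
    Integrable (fun ω => N.wealth 1 1 (X ω) i) P :=
  ((hN.isMonoSubmodular_wealth i).integrable_comp hX).congr (wealth_ae_eq hX0 i)

lemma OwesSociety.integrable_payment (hN : N.OwesSociety)
    (hX : ∀ i, Integrable (fun ω => X ω i) P) (hX0 : ∀ i, ∀ᵐ ω ∂P, 0 ≤ X ω i) (i : Fin n) :
    Integrable (fun ω => N.payment 1 1 (X ω) i) P :=
  ((hN.isMonoSubmodular_payment i).integrable_comp hX).congr (payment_ae_eq hX0 i)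

variable {m : MeasurableSpace Ω}

/-- The payment is the minimum of the affine functions `p̄` and `p̄ + v` of the wealth, so linearity
and monotonicity of the conditional expectation suffice. -/
lemma OwesSociety.condExp_payment_le_sub (hN : N.OwesSociety) (hm : m ≤ m₀)
    (hX : ∀ i, Integrable (fun ω => X ω i) P) (hX0 : ∀ i, ∀ᵐ ω ∂P, 0 ≤ X ω i) (i : Fin n) :
    P[fun ω => N.payment 1 1 (X ω) i | m]
      ≤ᵐ[P] fun ω => N.totalLiab i - (P[fun ω => N.wealth 1 1 (X ω) i | m] ω)⁻ := by
  have hV := hN.integrable_wealth hX hX0 i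
  have hp := hN.integrable_payment hX hX0 i
  have hc : Integrable (fun _ : Ω => N.totalLiab i) P := integrable_const _
  have h1 : P[fun ω => N.payment 1 1 (X ω) i | m] ≤ᵐ[P] P[fun _ => N.totalLiab i | m] :=
    condExp_mono hp hc (ae_of_all _ fun ω => sub_le_self _ (negPart_nonneg _))
  have h2 : P[fun ω => N.payment 1 1 (X ω) i | m]
      ≤ᵐ[P] P[(fun _ => N.totalLiab i) + fun ω => N.wealth 1 1 (X ω) i | m] := by
    refine condExp_mono hp (hc.add hV) (ae_of_all _ fun ω => ?_)
    have := neg_le_negPart (N.wealth 1 1 (X ω) i)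
    simp only [payment, Pi.add_apply]
    linarith
  have h3 := condExp_add (m := m) hc hV
  rw [condExp_const hm] at h1 h3
  filter_upwards [h1, h2, h3] with ω h1 h2 h3
  rw [h3, Pi.add_apply] at h2
  rw [negPart_def]
  rcases max_cases (-(P[fun ω => N.wealth 1 1 (X ω) i | m] ω)) 0 with h | h <;>
    rw [h.1] <;> linarith

/-- Jensen's inequality for clearing wealths. -/
lemma OwesSociety.condExp_wealth_le (hN : N.OwesSociety) (hm : m ≤ m₀)
    (hX : ∀ i, Integrable (fun ω => X ω i) P) (hX0 : ∀ i, ∀ᵐ ω ∂P, 0 ≤ X ω i) :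
    ∀ᵐ ω ∂P, (fun i => P[fun ω => N.wealth 1 1 (X ω) i | m] ω)
      ≤ N.wealth 1 1 fun i => P[fun ω => X ω i | m] ω := by
  have hp := hN.integrable_payment hX hX0
  -- The clearing equation is linear in endowments and payments, hence survives conditioning.
  have hlin : ∀ i, P[fun ω => N.wealth 1 1 (X ω) i | m] =ᵐ[P] fun ω =>
      P[fun ω => X ω i | m] ω
        + ∑ j, N.relLiab j i * P[fun ω => N.payment 1 1 (X ω) j | m] ω - N.totalLiab i := by
    intro i
    have hsum : Integrable (∑ j, N.relLiab j i • fun ω => N.payment 1 1 (X ω) j) P :=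
      integrable_finsetSum' _ fun j _ => (hp j).smul _
    have heq : (fun ω => N.wealth 1 1 (X ω) i) =ᵐ[P]
        ((fun ω => X ω i) + ∑ j, N.relLiab j i • fun ω => N.payment 1 1 (X ω) j)
          - fun _ => N.totalLiab i := by
      filter_upwards [ae_all_iff.2 hX0] with ω hω
      rw [wealth_eq (show (0 : Fin n → ℝ) ≤ X ω from hω)]
      simp [payment]
    have h1 := condExp_congr_ae (m := m) heq
    have h2 := condExp_sub (m := m) ((hX i).add hsum) (integrable_const (N.totalLiab i))
    have h3 := condExp_add (m := m) (hX i) hsum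
    have h4 := condExp_finsetSum (m := m) (s := Finset.univ) fun j _ => (hp j).smul (N.relLiab j i)
    have h5 : ∀ j, P[N.relLiab j i • fun ω => N.payment 1 1 (X ω) j | m]
        =ᵐ[P] N.relLiab j i • P[fun ω => N.payment 1 1 (X ω) j | m] :=
      fun j => condExp_smul _ _ _
    rw [condExp_const hm] at h2
    filter_upwards [h1, h2, h3, h4, ae_all_iff.2 h5] with ω h1 h2 h3 h4 h5
    rw [h1, h2, Pi.sub_apply, h3, Pi.add_apply, h4, Finset.sum_apply]
    simp only [h5, Pi.smul_apply, smul_eq_mul]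
  have hpos : ∀ i, 0 ≤ᵐ[P] P[fun ω => X ω i | m] := fun i => condExp_nonneg (hX0 i)
  filter_upwards [ae_all_iff.2 hlin, ae_all_iff.2 (hN.condExp_payment_le_sub hm hX hX0),
    ae_all_iff.2 hpos] with ω h1 h2 h3
  -- Bounding the conditioned payments by `p̄ - E[V | m]⁻` shows that `E[V | m]` is a subsolution
  -- for `E[X | m]`.
  refine hN.le_wealth h3 fun i => ?_
  rw [clearingMap_one]
  simp only []
  rw [h1 i]
  refine sub_le_sub_right (add_le_add le_rfl (Finset.sum_le_sum fun j _ => ?_)) _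
  exact mul_le_mul_of_nonneg_left (h2 j) (N.relLiab_nonneg j i)

/-- Jensen's inequality for clearing payments. -/
lemma OwesSociety.condExp_payment_le (hN : N.OwesSociety) (hm : m ≤ m₀)
    (hX : ∀ i, Integrable (fun ω => X ω i) P) (hX0 : ∀ i, ∀ᵐ ω ∂P, 0 ≤ X ω i) (i : Fin n) :
    ∀ᵐ ω ∂P, P[fun ω => N.payment 1 1 (X ω) i | m] ω
      ≤ N.payment 1 1 (fun i => P[fun ω => X ω i | m] ω) i := by
  filter_upwards [hN.condExp_wealth_le hm hX hX0, hN.condExp_payment_le_sub hm hX hX0 i]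
    with ω h1 h2
  exact h2.trans (sub_le_sub_left (negPart_anti (h1 i)) _)

/-- Conditional Jensen for the trivial σ-algebra; both sides are constants, so one good `ω` is
enough. -/
lemma OwesSociety.integral_wealth_le (hN : N.OwesSociety)
    (hX : ∀ i, Integrable (fun ω => X ω i) P) (hX0 : ∀ i, ∀ᵐ ω ∂P, 0 ≤ X ω i) (i : Fin n) :
    ∫ ω, N.wealth 1 1 (X ω) i ∂P ≤ N.wealth 1 1 (fun j => ∫ ω, X ω j ∂P) i := by
  have h := hN.condExp_wealth_le bot_le hX hX0
  simp only [condExp_bot] at h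
  obtain ⟨ω, hω⟩ := h.exists
  exact hω i

lemma OwesSociety.integral_payment_le (hN : N.OwesSociety)
    (hX : ∀ i, Integrable (fun ω => X ω i) P) (hX0 : ∀ i, ∀ᵐ ω ∂P, 0 ≤ X ω i) (i : Fin n) :
    ∫ ω, N.payment 1 1 (X ω) i ∂P ≤ N.payment 1 1 (fun j => ∫ ω, X ω j ∂P) i := by
  have h := hN.condExp_payment_le bot_le hX hX0 i
  simp only [condExp_bot] at h
  exact h.exists.choose_spec

end FinancialNetwork

end

/-! ### The chain of inequalities -/

theorem lemma5p2 {Ω : Type*} [MeasurableSpace Ω] (P : Measure Ω) [IsProbabilityMeasure P]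
    {n : ℕ} (N : FinancialNetwork n) (hN : N.OwesSociety)
    (X : Ω → Fin n → ℝ) (hXint : ∀ i, Integrable (fun ω => X ω i) P)
    (hXnonneg : ∀ i, ∀ᵐ ω ∂P, 0 ≤ X ω i)
    (U : Ω → ℝ) (hU : pdf.IsUniform U (Set.Icc 0 1) P volume) :
    -- the set over which the infimum is taken is nonempty
    (comonotonicFactors P X).Nonempty ∧
    ∀ i : Fin n,
      -- all the expectations below are those of integrable random variables
      (Integrable (fun ω => N.wealth 1 1 (comonotonicRearrangement P X U ω) i) P ∧
        Integrable (fun ω => N.wealth 1 1 (X ω) i) P ∧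
        (∀ W ∈ comonotonicFactors P X,
          Integrable (fun ω => N.wealth 1 1 (condMean P X W ω) i) P) ∧
        Integrable (fun ω => N.payment 1 1 (comonotonicRearrangement P X U ω) i) P ∧
        Integrable (fun ω => N.payment 1 1 (X ω) i) P ∧
        (∀ W ∈ comonotonicFactors P X,
          Integrable (fun ω => N.payment 1 1 (condMean P X W ω) i) P)) ∧
      -- the infima below are those of sets bounded below
      (BddBelow (Set.range fun W : comonotonicFactors P X =>
          ∫ ω, N.wealth 1 1 (condMean P X W ω) i ∂P) ∧
        BddBelow (Set.range fun W : comonotonicFactors P X =>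
          ∫ ω, N.payment 1 1 (condMean P X W ω) i ∂P)) ∧
      -- bounds on the expected wealth
      (∫ ω, N.wealth 1 1 (comonotonicRearrangement P X U ω) i ∂P
          ≤ ∫ ω, N.wealth 1 1 (X ω) i ∂P ∧
        ∫ ω, N.wealth 1 1 (X ω) i ∂P
          ≤ ⨅ W : comonotonicFactors P X, ∫ ω, N.wealth 1 1 (condMean P X W ω) i ∂P ∧
        (⨅ W : comonotonicFactors P X, ∫ ω, N.wealth 1 1 (condMean P X W ω) i ∂P)
          ≤ N.wealth 1 1 (fun j => ∫ ω, X ω j ∂P) i) ∧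
      -- bounds on the expected payment
      (∫ ω, N.payment 1 1 (comonotonicRearrangement P X U ω) i ∂P
          ≤ ∫ ω, N.payment 1 1 (X ω) i ∂P ∧
        ∫ ω, N.payment 1 1 (X ω) i ∂P
          ≤ ⨅ W : comonotonicFactors P X, ∫ ω, N.payment 1 1 (condMean P X W ω) i ∂P ∧
        (⨅ W : comonotonicFactors P X, ∫ ω, N.payment 1 1 (condMean P X W ω) i ∂P)
          ≤ N.payment 1 1 (fun j => ∫ ω, X ω j ∂P) i) := by
  have hZdist : ∀ j, IdentDistrib (fun ω => comonotonicRearrangement P X U ω j)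
      (fun ω => X ω j) P P := fun j =>
    identDistrib_quantile hU (hXint j).aemeasurable (hXnonneg j)
  have hZint : ∀ j, Integrable (fun ω => comonotonicRearrangement P X U ω j) P := fun j =>
    (hZdist j).integrable_iff.2 (hXint j)
  have hZ0 : ∀ j, ∀ᵐ ω ∂P, 0 ≤ comonotonicRearrangement P X U ω j := fun j =>
    ae_of_all _ fun ω => quantile_nonneg _
  have hCint : ∀ W j, Integrable (fun ω => condMean P X W ω j) P := fun W j => integrable_condExp
  have hC0 : ∀ W j, ∀ᵐ ω ∂P, 0 ≤ condMean P X W ω j := fun W j => condExp_nonneg (hXnonneg j)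
  have hCmean : ∀ W, Measurable W → ∀ j, ∫ ω, condMean P X W ω j ∂P = ∫ ω, X ω j ∂P :=
    fun W hW j => integral_condExp hW.comap_le
  have hcomon : ∀ f : (Fin n → ℝ) → ℝ, IsMonoSubmodular f →
      ∫ ω, f (comonotonicRearrangement P X U ω) ∂P ≤ ∫ ω, f (X ω) ∂P := fun f hf =>
    hf.integral_comonotonic_le (q := fun j => quantile (P.map fun ω => X ω j)) hU hXint hXnonneg
      (fun _ => monotoneOn_quantile) (fun _ _ => quantile_nonneg _) hZdist
  have hne := comonotonicFactors_nonempty hXint hXnonneg hU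
  have : Nonempty (comonotonicFactors P X) := hne.to_subtype
  refine ⟨hne, fun i => ?_⟩
  have hw : ∀ W : comonotonicFactors P X,
      ∫ ω, N.wealth 1 1 (X ω) i ∂P ≤ ∫ ω, N.wealth 1 1 (condMean P X W ω) i ∂P := fun W => by
    rw [← integral_condExp W.2.1.comap_le]
    refine integral_mono_ae integrable_condExp (hN.integrable_wealth (hCint W) (hC0 W) i) ?_
    filter_upwards [hN.condExp_wealth_le W.2.1.comap_le hXint hXnonneg] with ω hω
    exact hω i
  have hp : ∀ W : comonotonicFactors P X,
      ∫ ω, N.payment 1 1 (X ω) i ∂P ≤ ∫ ω, N.payment 1 1 (condMean P X W ω) i ∂P := fun W => by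
    rw [← integral_condExp W.2.1.comap_le]
    exact integral_mono_ae integrable_condExp (hN.integrable_payment (hCint W) (hC0 W) i)
      (hN.condExp_payment_le W.2.1.comap_le hXint hXnonneg i)
  have hbw : BddBelow (Set.range fun W : comonotonicFactors P X =>
      ∫ ω, N.wealth 1 1 (condMean P X W ω) i ∂P) :=
    ⟨_, Set.forall_mem_range.2 hw⟩
  have hbp : BddBelow (Set.range fun W : comonotonicFactors P X =>
      ∫ ω, N.payment 1 1 (condMean P X W ω) i ∂P) :=
    ⟨_, Set.forall_mem_range.2 hp⟩
  refine ⟨⟨hN.integrable_wealth hZint hZ0 i, hN.integrable_wealth hXint hXnonneg i,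
    fun W _ => hN.integrable_wealth (hCint W) (hC0 W) i, hN.integrable_payment hZint hZ0 i,
    hN.integrable_payment hXint hXnonneg i,
    fun W _ => hN.integrable_payment (hCint W) (hC0 W) i⟩, ⟨hbw, hbp⟩,
    ⟨?_, le_ciInf hw, ?_⟩, ⟨?_, le_ciInf hp, ?_⟩⟩
  · rw [← integral_congr_ae (FinancialNetwork.wealth_ae_eq hXnonneg i),
      ← integral_congr_ae (FinancialNetwork.wealth_ae_eq hZ0 i)]
    exact hcomon _ (hN.isMonoSubmodular_wealth i)
  -- Any single `W` works: Jensen is applied to `E[X | W]`, whose mean is `E[X]`.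
  · obtain ⟨W, hW⟩ := hne
    refine (ciInf_le hbw ⟨W, hW⟩).trans ?_
    simp_rw [← hCmean W hW.1]
    exact hN.integral_wealth_le (hCint W) (hC0 W) i
  · rw [← integral_congr_ae (FinancialNetwork.payment_ae_eq hXnonneg i),
      ← integral_congr_ae (FinancialNetwork.payment_ae_eq hZ0 i)]
    exact hcomon _ (hN.isMonoSubmodular_payment i)
  · obtain ⟨W, hW⟩ := hne
    refine (ciInf_le hbp ⟨W, hW⟩).trans ?_
    simp_rw [← hCmean W hW.1]
    exact hN.integral_payment_le (hCint W) (hC0 W) i
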